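/- Let $X=G/P$ be an irreducible compact Hermitian symmetric space: $G$ is a connected complex simple Lie group with Lie algebra $\mathfrak g$, $\mathfrak h$ is a Cartan subalgebra of $\mathfrak g$ with a choice of simple roots, and $P\subset G$ is the maximal parabolic subgroup attached to a simple root $\gamma$ whose coefficient in every root is $-1$, $0$ or $1$. Let $\Delta_M^+$ be the set of positive roots in which $\gamma$ occurs (the positive noncompact roots), and let the Lie algebra $\mathfrak p$ of $P$ be the sum of $\mathfrak h$ and of all root spaces $\mathfrak g_\beta$ with $\beta\notin\Delta_M^+$. Put $o=eP$, so that $T_o(X)=\mathfrak g/\mathfrak p$, on which $P$ acts by $\mathrm{Ad}$. Let $X\subset\mathbb P(V)$, $V=\Gamma(X,\mathcal O(1))^*$, be the minimal equivariant embedding, where $\mathcal O(1)$ is the ample generator of $\mathrm{Pic}(X)$; thus $V$ is the irreducible representation of $\mathfrak g$ whose lowest weight is the negative of the fundamental weight of $\gamma$, $o$ is its lowest weight line, and $X=G\cdot o$. The variety of minimal rational tangents $\mathcal C_o^1(X)\subset\mathbb P T_o(X)$ is the set of tangent directions at $o$ of the minimal rational curves of $X$ through $o$, that is, of the projective lines of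 $\mathbb P(V)$ through $o$ that are contained in $X$. For $k\ge 1$ let $$\mathcal C_o^k(X)=\overline{\bigcup_{a_1,\dots,a_k\in\mathcal C_o^1(X)}\langle a_1,\dots,a_k\rangle}\subset\mathbb P T_o(X)$$ be its $(k-1)$-th secant variety, where $\langle a_1,\dots,a_k\rangle$ is the projective linear span and the bar denotes Zariski closure. Let $\alpha_1,\dots,\alpha_r$ be the maximal sequence of pairwise strongly orthogonal roots in $\Delta_M^+$ starting from the highest root: each $\alpha_i$ is the highest among the roots in $\Delta_M^+$ strongly orthogonal to $\alpha_1,\dots,\alpha_{i-1}$, and no root in $\Delta_M^+$ is strongly orthogonal to all of them. (Two roots are strongly orthogonal if neither their sum nor their difference is a root or zero.) Let $e_{\alpha_i}$ be a nonzero root vector of $\alpha_i$. A nonzero tangent vector $w\in T_o(X)$ has rank $r_0$, with $1\le r_0\le r$, if $\mathrm{Ad}(p)\,w=\sum_{i=1}^{r_0}e_{\alpha_i}$ modulo $\mathfrak p$ for some $p\in P$. Then for every $k\ge 1$ $$\mathcal C_o^k(X)=\{[w]\in\mathbb P T_o(X) : \operatorname{rank}(w)\le k\}.$$ -/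

import Mathlib

open scoped LinearAlgebra.Projectivization

noncomputable section

/-! ### Zariski closure and secant varieties in a projective space -/

namespace Projectivization

variable {T : Type*} [AddCommGroup T] [Module ℂ T]

/-- The value at `v` of a polynomial function on `T`, written as a polynomial in linear forms. -/
def polyEval (f : MvPolynomial (Module.Dual ℂ T) ℂ) (v : T) : ℂ :=
  MvPolynomial.eval (fun φ : Module.Dual ℂ T => φ v) f

/-- The Zariski closure of `S ⊆ ℙ(T)`: the common zeros of all homogeneous polynomial functions
that vanish on `S`. -/
def zariskiClosure (S : Set (ℙ ℂ T)) : Set (ℙ ℂ T) :=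
  {t | ∀ (d : ℕ) (f : MvPolynomial (Module.Dual ℂ T) ℂ), f.IsHomogeneous d →
    (∀ s ∈ S, ∀ v ∈ s.submodule, v ≠ 0 → polyEval f v = 0) →
    ∀ v ∈ t.submodule, v ≠ 0 → polyEval f v = 0}

/-- The `(k-1)`-th secant variety of `C ⊆ ℙ(T)`: the Zariski closure of the union of the projective
linear subspaces spanned by `k` points `a₁, …, aₖ` of `C`. -/
def secantVariety (C : Set (ℙ ℂ T)) (k : ℕ) : Set (ℙ ℂ T) :=
  zariskiClosure {t | ∃ a : Fin k → ℙ ℂ T, (∀ i, a i ∈ C) ∧ t.submodule ≤ ⨆ i, (a i).submodule}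

end Projectivization

namespace HermitianSymmetric

/-! ### The group `G` and the homogeneous variety `X = G/P ⊆ ℙ(V)` -/

section Group

/-- The exponential of an endomorphism of a finite-dimensional complex vector space (computed in a
basis; it does not depend on the basis). -/
def expEnd {V : Type*} [AddCommGroup V] [Module ℂ V] [FiniteDimensional ℂ V]
    (A : Module.End ℂ V) : Module.End ℂ V :=
  Matrix.toLin (Module.finBasis ℂ V) (Module.finBasis ℂ V)
    (NormedSpace.exp (LinearMap.toMatrix (Module.finBasis ℂ V) (Module.finBasis ℂ V) A))

variable (𝔤 : Type*) [LieRing 𝔤] [LieAlgebra ℂ 𝔤]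
  (V : Type*) [AddCommGroup V] [Module ℂ V] [FiniteDimensional ℂ V]
  [LieRingModule 𝔤 V] [LieModule ℂ 𝔤 V]

/-- The connected complex Lie subgroup `G ⊆ GL(V)` whose Lie algebra is the image of `𝔤`: it is
generated by the exponentials of the elements of `𝔤`. -/
def group : Subgroup (V ≃ₗ[ℂ] V) :=
  Subgroup.closure {g | ∃ x : 𝔤, (g : V →ₗ[ℂ] V) = expEnd (LieModule.toEnd ℂ 𝔤 V x)}

variable {V}

/-- The variety `X = G · o ⊆ ℙ(V)`, the orbit of the base point `o`. -/
def variety (o : ℙ ℂ V) : Set (ℙ ℂ V) :=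
  MulAction.orbit (group 𝔤 V) o

/-- The parabolic subgroup `P ⊆ G`, the isotropy group of the base point `o`, so that
`X = G/P`. -/
def parabolicGroup (o : ℙ ℂ V) : Subgroup (group 𝔤 V) :=
  MulAction.stabilizer (group 𝔤 V) o

variable {𝔤}

/-- `y = Ad(g) x`, that is, `y` acts on `V` as `g ∘ x ∘ g⁻¹`. -/
def IsAd (g : group 𝔤 V) (x y : 𝔤) : Prop :=
  ∀ v : V, ⁅y, (g : V ≃ₗ[ℂ] V) v⁆ = (g : V ≃ₗ[ℂ] V) ⁅x, v⁆

end Group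

/-! ### Roots -/

section Roots

variable {𝔤 : Type*} [LieRing 𝔤] [LieAlgebra ℂ 𝔤] [FiniteDimensional ℂ 𝔤]
  [LieAlgebra.IsKilling ℂ 𝔤] {H : LieSubalgebra ℂ 𝔤} [H.IsCartanSubalgebra]
  (b : (LieAlgebra.IsKilling.rootSystem H).Base)

/-- The coefficient of the simple root `γ` in the root `β`. -/
def simpleCoeff (γ : b.support) (β : H.root) : ℂ :=
  b.toWeightBasis.repr ((LieAlgebra.IsKilling.rootSystem H).root β) γ

/-- The simple root `γ` is cominuscule: its coefficient in every root is `-1`, `0` or `1`.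
Equivalently the maximal parabolic subgroup attached to `γ` has abelian unipotent radical; this is
the case exactly when the flag variety `G/P` is the compact Hermitian symmetric space of `G`. -/
def IsCominuscule (γ : b.support) : Prop :=
  ∀ β : H.root, simpleCoeff b γ β = -1 ∨ simpleCoeff b γ β = 0 ∨ simpleCoeff b γ β = 1

/-- The positive noncompact roots `Δ⁺_M`: the positive roots in which `γ` occurs. -/
def noncompactPos (γ : b.support) : Set H.root :=
  {β | b.IsPos β ∧ simpleCoeff b γ β ≠ 0}

/-- The maximal parabolic subalgebra `𝔭 = 𝔨 + 𝔪⁻` of `𝔤`: the sum of the Cartan subalgebra and of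
all root spaces except those of the positive noncompact roots. -/
def parabolic (γ : b.support) : Submodule ℂ 𝔤 :=
  H.toSubmodule ⊔
    ⨆ β : {β : H.root // β ∉ noncompactPos b γ}, (LieAlgebra.rootSpace H β.1.1).toSubmodule

/-- The holomorphic tangent space `T_o(X) = 𝔤/𝔭` of `X = G/P` at the base point
(isomorphic to `𝔪⁺`). -/
abbrev Tangent (γ : b.support) : Type _ := 𝔤 ⧸ parabolic b γ

/-- Two roots are strongly orthogonal: neither their sum nor their difference is a root or zero. -/
def StronglyOrthogonal (α β : H.root) : Prop :=
  let R := (LieAlgebra.IsKilling.rootSystem H).root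
  R α + R β ∉ Set.range R ∧ R α + R β ≠ 0 ∧ R α - R β ∉ Set.range R ∧ R α - R β ≠ 0

/-- `α₁, …, α_r` is the maximal set `Π` of strongly orthogonal roots in `Δ⁺_M` starting from the
highest root: each `αᵢ` is the highest among the positive noncompact roots strongly orthogonal to
`α₁, …, αᵢ₋₁` (in particular `α₁` is the highest root), and no further root can be added. Its
length `r` is the rank of `X`. -/
structure IsMaximalStronglyOrthogonal (γ : b.support) {r : ℕ} (α : Fin r → H.root) : Prop where
  noncompact : ∀ i, α i ∈ noncompactPos b γ
  orthogonal : ∀ i j, i ≠ j → StronglyOrthogonal (α i) (α j)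
  highest : ∀ i, ∀ β ∈ noncompactPos b γ, (∀ j < i, StronglyOrthogonal (α j) β) →
    (LieAlgebra.IsKilling.rootSystem H).root (α i) - (LieAlgebra.IsKilling.rootSystem H).root β ∈
      AddSubmonoid.closure ((LieAlgebra.IsKilling.rootSystem H).root '' b.support)
  maximal : ∀ β ∈ noncompactPos b γ, ∃ i, ¬ StronglyOrthogonal (α i) β

variable {V : Type*} [AddCommGroup V] [Module ℂ V] [LieRingModule 𝔤 V]

/-- `v` spans the line fixed by `P` in the representation `V = Γ(X, 𝒪(1))^*`: it is a lowest weight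
vector whose weight is the negative of the fundamental weight attached to `γ`. -/
structure IsBaseVector (γ : b.support) (v : V) : Prop where
  ne_zero : v ≠ 0
  lowest : ∀ β : H.root, b.IsPos β → ∀ x ∈ LieAlgebra.rootSpace H (-β.1 : H → ℂ), ⁅x, v⁆ = 0
  weight_self : ⁅((LieAlgebra.IsKilling.rootSystem H).coroot γ : 𝔤), v⁆ = -v
  weight_other : ∀ β ∈ b.support, β ≠ γ →
    ⁅((LieAlgebra.IsKilling.rootSystem H).coroot β : 𝔤), v⁆ = 0

/-! ### Varieties of minimal rational tangents and ranks of tangent vectors -/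

variable [LieModule ℂ 𝔤 V] [FiniteDimensional ℂ V]

/-- The variety of minimal rational tangents `𝒞_o¹(X) ⊆ ℙ(T_o(X))` at `o = [v]`: the tangent
directions at `o` of the minimal rational curves of `X` through `o`, which are the projective lines
of `ℙ(V)` through `o` contained in `X` (all of them are free, `X` being homogeneous).
Here `L` is the plane of `V` whose projectivization is the line, and the tangent vector
`x mod 𝔭` of `X` points into the line when `x · v ∈ L`. -/
def vmrt (γ : b.support) (v : V) (hv : v ≠ 0) : Set (ℙ ℂ (Tangent b γ)) :=
  {t | ∃ L : Submodule ℂ V, Module.finrank ℂ L = 2 ∧ v ∈ L ∧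
    (∀ p : ℙ ℂ V, p.submodule ≤ L → p ∈ variety 𝔤 (Projectivization.mk ℂ v hv)) ∧
    ∃ (x : 𝔤) (hx : (parabolic b γ).mkQ x ≠ 0),
      t = Projectivization.mk ℂ ((parabolic b γ).mkQ x) hx ∧ ⁅x, v⁆ ∈ L}

/-- The tangent vector `w ∈ T_o(X)` has rank `r₀`: `Ad(p) w = e_{α₁} + … + e_{α_{r₀}}` for some
`p ∈ P` and `1 ≤ r₀ ≤ r`, where `e i` is a root vector of the root `αᵢ`. -/
def HasTangentRank (γ : b.support) (v : V) (hv : v ≠ 0) {r : ℕ} (e : Fin r → 𝔤)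
    (w : Tangent b γ) (r₀ : ℕ) : Prop :=
  1 ≤ r₀ ∧ r₀ ≤ r ∧ ∃ p ∈ parabolicGroup 𝔤 (Projectivization.mk ℂ v hv), ∃ x y : 𝔤,
    (parabolic b γ).mkQ x = w ∧ IsAd p x y ∧
    (parabolic b γ).mkQ y = ∑ i : Fin r with i.val < r₀, (parabolic b γ).mkQ (e i)

end Roots

end HermitianSymmetric

end

/-! Let Z (`gradingElement`) be the element of the Cartan subalgebra on which a root takes the value
of its γ-coefficient. It grades 𝔤 in degrees -1, 0, 1; 𝔭 is the part of degree at most 0, so a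
tangent vector w is the same thing as an element x of degree one, and elements of degree one
commute. Rank is measured by the powers of x on the base vector v: rank at most k turns out to mean
x^(k+1) v = 0, which is a polynomial condition on w.

Rank at most k gives a secant point, without taking a closure. The weight of v is -1 on the coroot
of every `α i` (`apply_coroot_eq_one`), hence (e i)² v = 0 and the plane spanned by v and (e i) v is
a line of X (`mem_vmrt_of_isAd`). A P-conjugate of a sum of s ≤ k of the e i therefore lies in the
span of k points of the variety of minimal rational tangents.

Conversely, X satisfies quadratic equations (`lie_moment`). If a line through o with direction x
lies in X, then [x v] is a point of X and these equations give x² v = 0 (`lie_lie_base_eq_zero`). A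
sum of k commuting elements of this kind has its (k+1)-st power killing v, and this passes to the
Zariski closure (`pow_tangentLift_apply_eq_zero`). Every x is P-conjugate to e 0 + … + e (s-1) for
some s (`exists_isAd_sum`), and the s-th power of that sum does not kill v (`sum_pow_base_ne_zero`);
hence s ≤ k.

The normal form is a Gaussian elimination along the strongly orthogonal roots: degree-zero root
vectors move a nonzero component up to the highest available root (`exists_raise_top`), the other
components not orthogonal to that root are cleared (`exists_clear`), and the process continues among
the roots orthogonal to it. All conjugations fix the part already reached. -/

noncomputable section

set_option linter.unusedSectionVars false

/-! ### Cascades of orthogonal roots in a root system graded by a simple root -/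

namespace RootPairing

open Set

variable {ι R M N : Type*} [Finite ι] [Field R] [CharZero R] [AddCommGroup M] [Module R M]
  [AddCommGroup N] [Module R N] {P : RootPairing ι R M N} [P.IsRootSystem] [P.IsCrystallographic] (b : P.Base)

omit [Finite ι] [P.IsCrystallographic] [CharZero R] in
lemma Base.exists_nat_repr_eq {x : M} (hx : x ∈ AddSubmonoid.closure (P.root '' b.support)) :
    ∃ n : b.support → ℕ, ∀ a, b.toWeightBasis.repr x a = n a := by
  induction hx using AddSubmonoid.closure_induction with
  | mem x hx =>
    classical
    obtain ⟨a, ha, rfl⟩ := hx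
    refine ⟨fun a' => if (⟨a, ha⟩ : b.support) = a' then 1 else 0, fun a' => ?_⟩
    rw [b.toWeightBasis_repr_root ⟨a, ha⟩, Finsupp.single_apply]
    split_ifs <;> simp_all
  | zero => exact ⟨0, by simp⟩
  | add x y _ _ hx hy =>
    obtain ⟨n, hn⟩ := hx
    obtain ⟨m, hm⟩ := hy
    exact ⟨n + m, fun a => by simp [hn, hm]⟩

omit [Finite ι] [P.IsCrystallographic] in
lemma Base.eq_zero_of_mem_closure_of_neg_mem {x : M}
    (hx : x ∈ AddSubmonoid.closure (P.root '' b.support))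
    (hx' : -x ∈ AddSubmonoid.closure (P.root '' b.support)) : x = 0 := by
  obtain ⟨n, hn⟩ := b.exists_nat_repr_eq hx
  obtain ⟨m, hm⟩ := b.exists_nat_repr_eq hx'
  refine b.toWeightBasis.ext_elem fun a => ?_
  have h : ((n a + m a : ℕ) : R) = 0 := by
    push_cast
    rw [← hn, ← hm]
    simp
  have h' : n a = 0 := by
    have := Nat.cast_eq_zero.mp h
    lia
  simp [hn, h']

/-- The roots of degree one with respect to `c` which are orthogonal to the first `j` roots of the
family `α`. -/
def Level (P : RootPairing ι R M N) (c : M →ₗ[R] R) {r : ℕ} (α : Fin r → ι) (j : ℕ) (β : ι) :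
    Prop :=
  c (P.root β) = 1 ∧ ∀ i : Fin r, i.val < j → P.pairing β (α i) = 0

/-- A family of pairwise orthogonal roots of degree one with respect to the coordinate `c` of a
simple root `γ`, each of them the highest root of degree one orthogonal to the previous ones. -/
structure Base.IsCascade (c : M →ₗ[R] R) (γ : b.support) {r : ℕ} (α : Fin r → ι) : Prop where
  grading : ∀ i, c (P.root i) = -1 ∨ c (P.root i) = 0 ∨ c (P.root i) = 1
  self : c (P.root γ) = 1
  simple : ∀ a : b.support, a ≠ γ → c (P.root a) = 0
  level : ∀ i, P.Level c α i.val (α i)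
  highest : ∀ i β, P.Level c α i.val β →
    P.root (α i) - P.root β ∈ AddSubmonoid.closure (P.root '' b.support)

omit [P.IsRootSystem] in
-- A negative pairing would make the sum of the two roots a root of degree two.
lemma pairingIn_nonneg_of_degree_one {c : M →ₗ[R] R}
    (hc : ∀ i, c (P.root i) = -1 ∨ c (P.root i) = 0 ∨ c (P.root i) = 1)
    {β δ : ι} (hβ : c (P.root β) = 1) (hδ : c (P.root δ) = 1) : 0 ≤ P.pairingIn ℤ β δ := by
  by_contra! h
  have hne : P.root β ≠ -P.root δ := fun h' => by
    have := congrArg c h'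
    rw [map_neg, hβ, hδ] at this
    norm_num at this
  obtain ⟨k, hk⟩ := P.root_add_root_mem_of_pairingIn_neg h hne
  have h2 : c (P.root k) = 2 := by rw [hk, map_add, hβ, hδ]; norm_num
  rcases hc k with h | h | h <;> rw [h] at h2 <;> norm_num at h2

omit [Finite ι] [CharZero R] [P.IsRootSystem] in
lemma pairing_eq_intCast (i j : ι) : P.pairing i j = (P.pairingIn ℤ i j : R) := by
  rw [← P.algebraMap_pairingIn ℤ]; rfl

namespace Base.IsCascade

variable {b} {c : M →ₗ[R] R} {γ : b.support} {r : ℕ} {α : Fin r → ι} (h : b.IsCascade c γ α)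

include h

omit [Finite ι] in
-- Reflecting β in `α i` changes the degree to 1 - n, so n = 2 and 2 `α i` - β is a root of the same
-- level. Since `α i` is highest in its level, both `α i` - β and its negative are nonnegative
-- combinations of simple roots.
lemma eq_of_two_le_pairingIn {i : Fin r} {β : ι} (hβ : P.Level c α i.val β)
    (h2 : 2 ≤ P.pairingIn ℤ β (α i)) : β = α i := by
  set n := P.pairingIn ℤ β (α i) with hn
  have hs := P.root_reflectionPerm (α i) β
  rw [reflection_apply_root, pairing_eq_intCast, ← hn] at hs
  have hcs : c (P.root (P.reflectionPerm (α i) β)) = 1 - n := by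
    rw [hs, map_sub, map_smul, hβ.1, (h.level i).1]; simp
  have hn2 : n = 2 := by
    rcases h.grading (P.reflectionPerm (α i) β) with h' | h' | h' <;> rw [hcs] at h'
    · have : (n : R) = (2 : ℤ) := by push_cast; linear_combination -h'
      exact_mod_cast this
    · have : (n : R) = (1 : ℤ) := by push_cast; linear_combination -h'
      have : n = 1 := by exact_mod_cast this
      lia
    · have : (n : R) = (0 : ℤ) := by push_cast; linear_combination -h'
      have : n = 0 := by exact_mod_cast this
      lia
  rw [hn2] at hs
  -- Reflecting a root in itself negates it: ρ is 2 `α i` - β.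
  set ρ := P.reflectionPerm (P.reflectionPerm (α i) β) (P.reflectionPerm (α i) β) with hρ
  have hrρ : P.root ρ = (2 : R) • P.root (α i) - P.root β := by
    rw [hρ, root_reflectionPerm, reflection_apply_self, hs]
    push_cast
    abel
  have hlev : P.Level c α i.val ρ := by
    refine ⟨?_, fun l hl => ?_⟩
    · rw [hrρ, map_sub, map_smul, hβ.1, (h.level i).1]; simp; norm_num
    · have h1 := hβ.2 l hl
      have h3 := (h.level i).2 l hl
      rw [← root_coroot'_eq_pairing] at h1 h3 ⊢
      rw [hrρ, map_sub, map_smul, h1, h3]; simp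
  have hp := h.highest i β hβ
  have hm := h.highest i ρ hlev
  have := b.eq_zero_of_mem_closure_of_neg_mem hp (by
    convert hm using 1
    rw [hrρ, two_smul]; abel)
  exact (P.root.injective (sub_eq_zero.mp this)).symm

/-- Write `α i` - β as a nonnegative combination of simple roots. Comparing degrees excludes γ,
maximality of the earlier `α l` makes every simple root that occurs orthogonal to them, and
evaluation on the coroot of β leaves a negative term. -/
lemma exists_simple_pairingIn_neg {i : Fin r} {β : ι} (hβ : P.Level c α i.val β)
    (h0 : P.pairing β (α i) = 0) :
    ∃ a ∈ b.support, c (P.root a) = 0 ∧ (∀ l : Fin r, l < i → P.pairing a (α l) = 0) ∧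
      P.pairingIn ℤ β a < 0 := by
  obtain ⟨n, hn⟩ := b.exists_nat_repr_eq (h.highest i β hβ)
  have hsum : P.root (α i) - P.root β = ∑ a : b.support, (n a : R) • P.root a := by
    rw [← b.toWeightBasis.sum_repr (P.root (α i) - P.root β)]
    simp_rw [hn, b.toWeightBasis_apply]
  have hγ : n γ = 0 := by
    have := congrArg c hsum
    rw [map_sub, hβ.1, (h.level i).1, map_sum, Finset.sum_eq_single γ] at this
    · simpa [h.self, eq_comm] using this
    · intro a _ ha
      simp [h.simple a ha]
    · simp
  have hc0 (a : b.support) (ha : n a ≠ 0) : c (P.root a) = 0 :=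
    h.simple a fun h' => ha (h' ▸ hγ)
  -- Strong induction on l: a negative pairing with `α l` would make `α l` + a a root, still
  -- orthogonal to the earlier members, and higher than `α l`. So all terms of a vanishing sum are
  -- nonnegative.
  have horth : ∀ m : ℕ, ∀ l : Fin r, l.val = m → l < i → ∀ a : b.support, n a ≠ 0 →
      P.pairing a (α l) = 0 := by
    intro m
    induction m using Nat.strong_induction_on with
    | _ m ih =>
      intro l hl hli a ha
      have key : ∑ a : b.support, (n a : ℤ) * P.pairingIn ℤ a (α l) = 0 := by
        have := congrArg (P.coroot' (α l)) hsum
        rw [map_sub, root_coroot'_eq_pairing, root_coroot'_eq_pairing, hβ.2 l hli,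
          (h.level i).2 l hli, map_sum] at this
        simp only [map_smul, root_coroot'_eq_pairing, pairing_eq_intCast, smul_eq_mul] at this
        have h' : ((∑ a : b.support, (n a : ℤ) * P.pairingIn ℤ a (α l) : ℤ) : R) = 0 := by
          push_cast
          rw [← this]; simp
        exact_mod_cast h'
      have hnn : ∀ a : b.support, 0 ≤ (n a : ℤ) * P.pairingIn ℤ a (α l) := by
        intro a
        by_cases ha : n a = 0
        · simp [ha]
        refine mul_nonneg (by positivity) ?_
        by_contra! hneg
        have hne : P.root a ≠ -P.root (α l) := fun h' => by
          have := congrArg c h'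
          rw [map_neg, hc0 a ha, (h.level l).1] at this
          norm_num at this
        obtain ⟨k, hk⟩ := P.root_add_root_mem_of_pairingIn_neg hneg hne
        have hlev : P.Level c α l.val k := by
          refine ⟨by rw [hk, map_add, hc0 a ha, (h.level l).1, zero_add], fun l' hl' => ?_⟩
          rw [← root_coroot'_eq_pairing, hk, map_add, root_coroot'_eq_pairing,
            root_coroot'_eq_pairing, (h.level l).2 l' hl',
            ih l'.val (hl ▸ hl') l' rfl (lt_trans hl' hli) a ha, zero_add]
        have h1 := h.highest l k hlev
        rw [hk] at h1
        have h2 : -P.root a ∈ AddSubmonoid.closure (P.root '' b.support) := by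
          convert h1 using 1; abel
        have := b.eq_zero_of_mem_closure_of_neg_mem
          (AddSubmonoid.subset_closure (mem_image_of_mem _ a.2)) h2
        exact P.ne_zero _ this
      have := (Finset.sum_eq_zero_iff_of_nonneg fun a _ => hnn a).mp key a (Finset.mem_univ _)
      rw [pairing_eq_intCast]
      rcases mul_eq_zero.mp this with h' | h'
      · exact absurd (by exact_mod_cast h') ha
      · rw [h']; simp
  have hneg : ∑ a : b.support, (n a : ℤ) * P.pairingIn ℤ a β < 0 := by
    have := congrArg (P.coroot' β) hsum
    have h0' : P.pairing (α i) β = 0 := P.pairing_eq_zero_iff.mp h0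
    rw [map_sub, root_coroot'_eq_pairing, root_coroot'_eq_pairing, h0', pairing_same,
      map_sum] at this
    simp only [map_smul, root_coroot'_eq_pairing, pairing_eq_intCast, smul_eq_mul] at this
    have h' : ((∑ a : b.support, (n a : ℤ) * P.pairingIn ℤ a β : ℤ) : R) = (-2 : ℤ) := by
      push_cast
      rw [← this]; simp
    have : ∑ a : b.support, (n a : ℤ) * P.pairingIn ℤ a β = -2 := by exact_mod_cast h'
    lia
  obtain ⟨a, -, ha⟩ := Finset.exists_lt_of_sum_lt (s := Finset.univ)
    (f := fun a : b.support => (n a : ℤ) * P.pairingIn ℤ a β) (g := fun _ => 0) (by simpa using hneg)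
  have hna : n a ≠ 0 := by rintro h'; simp [h'] at ha
  refine ⟨a, a.2, hc0 a hna, fun l hl => horth l l rfl hl a hna, ?_⟩
  rw [P.pairingIn_lt_zero_iff]
  exact neg_of_mul_neg_right ha (by positivity)

/-- Induction for the roots of a level, upwards along simple roots, starting from the roots which
are not orthogonal to the top one. -/
lemma level_induction (i : Fin r) {p : ι → Prop}
    (base : ∀ β, P.Level c α i.val β → 0 < P.pairingIn ℤ β (α i) → p β)
    (step : ∀ β a, P.Level c α i.val β → a ∈ b.support → c (P.root a) = 0 →
      (∀ l : Fin r, l < i → P.pairing a (α l) = 0) → P.pairingIn ℤ β a < 0 →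
      (∀ β' (k : ℕ), 0 < k → P.root β' = P.root β + (k : R) • P.root a →
        P.Level c α i.val β' ∧ p β') → p β)
    {β : ι} (hβ : P.Level c α i.val β) : p β := by
  -- Heights are bounded, so the induction runs on the distance of the height from B.
  obtain ⟨B, hB⟩ : ∃ B : ℤ, ∀ β, b.height β ≤ B := by
    obtain ⟨B, hB⟩ := (Set.finite_range b.height).bddAbove
    exact ⟨B, fun β => hB (mem_range_self β)⟩
  obtain ⟨n, hn⟩ : ∃ n : ℕ, B - b.height β ≤ n := ⟨_, Int.self_le_toNat _⟩
  induction n using Nat.strong_induction_on generalizing β with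
  | _ n ih =>
    by_cases h0 : P.pairing β (α i) = 0
    · obtain ⟨a, ha, hca, hla, hneg⟩ := h.exists_simple_pairingIn_neg hβ h0
      refine step β a hβ ha hca hla hneg fun β' k hk hβ' => ?_
      have hlev : P.Level c α i.val β' := by
        refine ⟨by rw [hβ', map_add, map_smul, hβ.1, hca]; simp, fun l hl => ?_⟩
        rw [← root_coroot'_eq_pairing, hβ', map_add, map_smul, root_coroot'_eq_pairing,
          root_coroot'_eq_pairing, hla l hl, hβ.2 l hl]
        simp
      refine ⟨hlev, ?_⟩
      have hht : b.height β' = b.height β + k := by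
        have hβ'' : P.root β' = P.root β + (k : ℤ) • P.root a := by
          rw [hβ']; simp [Nat.cast_smul_eq_nsmul]
        rw [b.height_add_zsmul hβ'', Base.height_one_of_mem_support ha]
        simp
      have hBβ' := hB β'
      exact ih (B - b.height β').toNat (by lia) hlev (Int.self_le_toNat _)
    · refine base β hβ (lt_of_le_of_ne
        (pairingIn_nonneg_of_degree_one h.grading hβ.1 (h.level i).1) fun h' => h0 ?_)
      rw [pairing_eq_intCast, ← h']; simp

/-! ### Root lengths along a cascade. -/

section Length

variable [Fintype ι]

omit [Finite ι] [P.IsRootSystem] h in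
lemma _root_.RootPairing.rootLength_reflectionPerm (i j : ι) :
    (P.posRootForm ℤ).rootLength (P.reflectionPerm i j) = (P.posRootForm ℤ).rootLength j := by
  apply FaithfulSMul.algebraMap_injective ℤ R
  rw [RootPositiveForm.algebraMap_rootLength, RootPositiveForm.algebraMap_rootLength,
    root_reflectionPerm]
  exact (P.posRootForm ℤ).isOrthogonal_reflection i _ _

omit [Finite ι] in
-- Reflections in simple roots climb the level without changing lengths, until orthogonality to `α
-- i` fails.
lemma exists_level_pairingIn_pos {i : Fin r} {β : ι} (hβ : P.Level c α i.val β) :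
    ∃ β', P.Level c α i.val β' ∧ 0 < P.pairingIn ℤ β' (α i) ∧
      (P.posRootForm ℤ).rootLength β' = (P.posRootForm ℤ).rootLength β := by
  refine h.level_induction i (p := fun β => ∃ β', P.Level c α i.val β' ∧
    0 < P.pairingIn ℤ β' (α i) ∧ (P.posRootForm ℤ).rootLength β' =
      (P.posRootForm ℤ).rootLength β) (fun β hβ hpos => ⟨β, hβ, hpos, rfl⟩) ?_ hβ
  intro β a _ _ _ _ hneg H
  obtain ⟨n, hn⟩ := Int.eq_ofNat_of_zero_le (neg_nonneg.mpr hneg.le)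
  have hr : P.root (P.reflectionPerm a β) = P.root β + (n : R) • P.root a := by
    have hn' : P.pairingIn ℤ β a = -n := by lia
    rw [root_reflectionPerm, reflection_apply_root, pairing_eq_intCast, hn']
    push_cast
    rw [neg_smul, sub_neg_eq_add]
  obtain ⟨-, β', h1, h2, h3⟩ := H _ n (by lia) hr
  exact ⟨β', h1, h2, h3.trans (rootLength_reflectionPerm a β)⟩

omit [Finite ι] in
lemma rootLength_eq_mul {i : Fin r} {β : ι} (hβ : P.Level c α i.val β)
    (hpos : 0 < P.pairingIn ℤ β (α i)) :
    β = α i ∨ (P.pairingIn ℤ β (α i) = 1 ∧ 0 < P.pairingIn ℤ (α i) β ∧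
      (P.posRootForm ℤ).rootLength (α i) =
      P.pairingIn ℤ (α i) β * (P.posRootForm ℤ).rootLength β) := by
  by_cases h2 : 2 ≤ P.pairingIn ℤ β (α i)
  · exact Or.inl (h.eq_of_two_le_pairingIn hβ h2)
  have h1 : P.pairingIn ℤ β (α i) = 1 := by lia
  have hsw := (P.posRootForm ℤ).pairingIn_mul_eq_pairingIn_mul_swap (α i) β
  rw [h1, one_mul] at hsw
  exact Or.inr ⟨h1, (P.zero_lt_pairingIn_iff' ℤ).mp hpos, hsw⟩

omit [Finite ι] in
-- A root of the level not orthogonal to `α i`, and other than it, pairs to 1 with `α i`; the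
-- squared length of `α i` is then a positive integer multiple of its own.
lemma rootLength_le {i : Fin r} {β : ι} (hβ : P.Level c α i.val β) :
    (P.posRootForm ℤ).rootLength β ≤ (P.posRootForm ℤ).rootLength (α i) := by
  obtain ⟨β', hβ', hpos, hq⟩ := h.exists_level_pairingIn_pos hβ
  rw [← hq]
  rcases h.rootLength_eq_mul hβ' hpos with rfl | ⟨-, ht, hm⟩
  · exact le_rfl
  · have := (P.posRootForm ℤ).rootLength_pos β'
    rw [hm]
    nlinarith

omit [Finite ι] in
-- For a shorter β' with positive pairing, the degree of its reflection of `α i` forces that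
-- reflection to be `α i` - 2β'. Its negative has degree one, is orthogonal to `α i` because 2·1 - 2
-- = 0, and has the length of `α i`.
lemma exists_level_succ_rootLength_eq {i : Fin r} {β : ι} (hβ : P.Level c α i.val β)
    (hlt : (P.posRootForm ℤ).rootLength β < (P.posRootForm ℤ).rootLength (α i)) :
    ∃ μ, P.Level c α (i.val + 1) μ ∧
      (P.posRootForm ℤ).rootLength μ = (P.posRootForm ℤ).rootLength (α i) := by
  obtain ⟨β', hβ', hpos, hq⟩ := h.exists_level_pairingIn_pos hβ
  rw [← hq] at hlt
  rcases h.rootLength_eq_mul hβ' hpos with rfl | ⟨h1, ht, hm⟩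
  · exact absurd hlt (lt_irrefl _)
  set t := P.pairingIn ℤ (α i) β' with htdef
  have hpos' := (P.posRootForm ℤ).rootLength_pos β'
  have ht2 : 2 ≤ t := by
    by_contra! h'
    have : t = 1 := by lia
    rw [hm, this] at hlt
    simp at hlt
  set ρ := P.reflectionPerm β' (α i) with hρ
  have hρr : P.root ρ = P.root (α i) - (t : R) • P.root β' := by
    rw [hρ, root_reflectionPerm, reflection_apply_root, pairing_eq_intCast]
  have hcρ : c (P.root ρ) = ((1 - t : ℤ) : R) := by
    rw [hρr, map_sub, map_smul, hβ'.1, (h.level i).1]; simp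
  have ht2 : t = 2 := by
    rcases h.grading ρ with h' | h' | h' <;> rw [hcρ] at h'
    · have : 1 - t = -1 := by exact_mod_cast h'
      lia
    · have : 1 - t = 0 := by exact_mod_cast h'
      lia
    · have : 1 - t = 1 := by exact_mod_cast h'
      lia
  rw [ht2] at hρr
  refine ⟨P.reflectionPerm ρ ρ, ?_, ?_⟩
  · have hr : P.root (P.reflectionPerm ρ ρ) = (2 : R) • P.root β' - P.root (α i) := by
      rw [root_reflectionPerm, reflection_apply_self, hρr]
      push_cast
      abel
    refine ⟨?_, fun l hl => ?_⟩
    · rw [hr, map_sub, map_smul, hβ'.1, (h.level i).1]; simp; norm_num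
    · rw [← root_coroot'_eq_pairing, hr, map_sub, map_smul, root_coroot'_eq_pairing,
        root_coroot'_eq_pairing]
      rcases Nat.lt_succ_iff_lt_or_eq.mp hl with hl | hl
      · rw [hβ'.2 l hl, (h.level i).2 l hl]; simp
      · rw [Fin.ext hl, pairing_same, pairing_eq_intCast, h1]; simp
  · rw [rootLength_reflectionPerm, hρ, rootLength_reflectionPerm]

omit [Finite ι] in
-- Lengths never drop along the cascade: if the next root were shorter, the next level would contain
-- a root of the previous length, although its top root is longest. At level zero γ itself is a
-- competitor.
lemma rootLength_simple_le (i : Fin r) :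
    (P.posRootForm ℤ).rootLength γ ≤ (P.posRootForm ℤ).rootLength (α i) := by
  obtain ⟨n, hn⟩ := i
  induction n with
  | zero => exact h.rootLength_le ⟨h.self, fun l hl => absurd hl (Nat.not_lt_zero _)⟩
  | succ n ih =>
    refine (ih (Nat.lt_of_succ_lt hn)).trans ?_
    by_contra! hlt
    have hlev : P.Level c α n (α ⟨n + 1, hn⟩) :=
      ⟨(h.level _).1, fun l hl => (h.level _).2 l (Nat.lt_succ_of_lt hl)⟩
    obtain ⟨μ, hμ, hμq⟩ := h.exists_level_succ_rootLength_eq (i := ⟨n, Nat.lt_of_succ_lt hn⟩)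
      hlev hlt
    have := h.rootLength_le (i := ⟨n + 1, hn⟩) hμ
    lia

omit [Finite ι] in
-- The left side is twice l composed with the polarization, hence linear in the root, so it suffices
-- to compare values on simple roots.
lemma rootLength_mul_apply_coroot {l : N →ₗ[R] R} (hl1 : l (P.coroot γ) = 1)
    (hl0 : ∀ a : b.support, a ≠ γ → l (P.coroot a) = 0) (β : ι) :
    ((P.posRootForm ℤ).rootLength β : R) * l (P.coroot β) =
      c (P.root β) * (P.posRootForm ℤ).rootLength γ := by
  have hq (β : ι) : ((P.posRootForm ℤ).rootLength β : R) = P.RootForm (P.root β) (P.root β) :=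
    (P.posRootForm ℤ).algebraMap_rootLength β
  have key (β : ι) : P.RootForm (P.root β) (P.root β) * l (P.coroot β) =
      (2 • l ∘ₗ P.Polarization) (P.root β) := by
    rw [← smul_eq_mul, ← map_smul, rootForm_self_smul_coroot]
    simp
  have hlin : (2 • l ∘ₗ P.Polarization : M →ₗ[R] R) =
      (P.RootForm (P.root γ) (P.root γ)) • c := by
    refine b.toWeightBasis.ext fun a => ?_
    rw [b.toWeightBasis_apply, ← key]
    by_cases ha : a = γ
    · subst ha
      simp [hl1, h.self]
    · simp [hl0 a ha, h.simple a ha]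
  rw [hq, hq, key, hlin]
  simp [mul_comm]

omit [Finite ι] in
-- The value is an integer n with n |`α i`|² = |γ|², and |γ| ≤ |`α i`| leaves only n = 1. This is
-- what makes root vectors of `α i` act on v with square zero.
lemma apply_coroot_eq_one {l : N →ₗ[R] R} (hl1 : l (P.coroot γ) = 1)
    (hl0 : ∀ a : b.support, a ≠ γ → l (P.coroot a) = 0) (i : Fin r) :
    l (P.coroot (α i)) = 1 := by
  have hint : ∀ β, ∃ n : ℤ, l (P.coroot β) = n := by
    intro β
    have hmem := b.coroot_mem_span_int β
    generalize P.coroot β = y at hmem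
    induction hmem using Submodule.span_induction with
    | mem x hx =>
      obtain ⟨a, ha, rfl⟩ := hx
      by_cases haγ : (⟨a, ha⟩ : b.support) = γ
      · exact ⟨1, by subst haγ; simpa using hl1⟩
      · exact ⟨0, by simpa using hl0 _ haγ⟩
    | zero => exact ⟨0, by simp⟩
    | add x y _ _ hx hy =>
      obtain ⟨n, hn⟩ := hx
      obtain ⟨m, hm⟩ := hy
      exact ⟨n + m, by simp [hn, hm]⟩
    | smul z x _ hx =>
      obtain ⟨n, hn⟩ := hx
      exact ⟨z * n, by simp [hn]⟩
  obtain ⟨n, hn⟩ := hint (α i)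
  have h1 := h.rootLength_mul_apply_coroot hl1 hl0 (α i)
  rw [hn, (h.level i).1, one_mul] at h1
  have h2 : (P.posRootForm ℤ).rootLength (α i) * n = (P.posRootForm ℤ).rootLength γ := by
    exact_mod_cast h1
  have hle := h.rootLength_simple_le i
  have hγ := (P.posRootForm ℤ).rootLength_pos γ
  have hα := (P.posRootForm ℤ).rootLength_pos (α i)
  have hn1 : 0 < n := by
    by_contra! h'
    nlinarith
  have hn2 : n ≤ 1 := by
    by_contra! h'
    nlinarith
  rw [hn, show n = 1 by lia]
  simp

end Length

end Base.IsCascade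

end RootPairing

/-! ### The exponential of an endomorphism and the adjoint action -/

namespace HermitianSymmetric

section Exp

variable {V : Type*} [AddCommGroup V] [Module ℂ V] [FiniteDimensional ℂ V]

lemma eq_of_forall_linearMap_eq {W : Type*} [AddCommGroup W] [Module ℂ W] {u w : W}
    (h : ∀ φ : W →ₗ[ℂ] ℂ, φ u = φ w) : u = w := by
  rw [← sub_eq_zero, ← Module.forall_dual_apply_eq_zero_iff ℂ]
  intro φ
  rw [map_sub, h φ, sub_self]

/-- Testing the exponential series against linear functionals turns identities between operators
into uniqueness of scalar sums; a norm is needed on matrices only, and only here. -/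
lemma hasSum_expEnd (A : Module.End ℂ V) (φ : Module.End ℂ V →ₗ[ℂ] ℂ) :
    HasSum (fun n : ℕ => (n.factorial : ℂ)⁻¹ * φ (A ^ n)) (φ (expEnd A)) := by
  set B := Module.finBasis ℂ V
  let _ : NormedRing (Matrix (Fin (Module.finrank ℂ V)) (Fin (Module.finrank ℂ V)) ℂ) :=
    Matrix.linftyOpNormedRing
  let _ : NormedAlgebra ℂ (Matrix (Fin (Module.finrank ℂ V)) (Fin (Module.finrank ℂ V)) ℂ) :=
    Matrix.linftyOpNormedAlgebra
  have h := NormedSpace.exp_series_hasSum_exp' (𝕂 := ℂ) (LinearMap.toMatrix B B A)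
  let ψ : Matrix (Fin (Module.finrank ℂ V)) (Fin (Module.finrank ℂ V)) ℂ →ₗ[ℂ] ℂ :=
    φ ∘ₗ (Matrix.toLin B B).toLinearMap
  have h' := h.map ψ.toAddMonoidHom ψ.continuous_of_finiteDimensional
  have e : (⇑ψ.toAddMonoidHom ∘ fun n : ℕ => (n.factorial : ℂ)⁻¹ • LinearMap.toMatrix B B A ^ n) =
      fun n : ℕ => (n.factorial : ℂ)⁻¹ * φ (A ^ n) := by
    funext n
    have : LinearMap.toMatrix B B A ^ n = LinearMap.toMatrix B B (A ^ n) :=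
      LinearMap.toMatrix_pow B A n
    simp [ψ, this]
  rw [e] at h'
  exact h'

lemma hasSum_expEnd_apply (A : Module.End ℂ V) (u : V) (φ : V →ₗ[ℂ] ℂ) :
    HasSum (fun n : ℕ => (n.factorial : ℂ)⁻¹ * φ ((A ^ n) u)) (φ (expEnd A u)) :=
  hasSum_expEnd A (φ ∘ₗ LinearMap.applyₗ u)

lemma expEnd_add_of_commute {A B : Module.End ℂ V} (h : Commute A B) :
    expEnd (A + B) = expEnd A * expEnd B := by
  have h' : Commute (LinearMap.toMatrix (Module.finBasis ℂ V) (Module.finBasis ℂ V) A)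
      (LinearMap.toMatrix (Module.finBasis ℂ V) (Module.finBasis ℂ V) B) := by
    rw [Commute, SemiconjBy, ← LinearMap.toMatrix_mul, ← LinearMap.toMatrix_mul, h.eq]
  rw [expEnd, map_add, Matrix.exp_add_of_commute _ _ h']
  exact Matrix.toLin_mul _ _ _ _ _

lemma expEnd_apply_of_pow_apply_eq_zero {A : Module.End ℂ V} {u : V} {N : ℕ}
    (h : (A ^ N) u = 0) :
    expEnd A u = ∑ n ∈ Finset.range N, (n.factorial : ℂ)⁻¹ • (A ^ n) u := by
  refine eq_of_forall_linearMap_eq fun φ => (hasSum_expEnd_apply A u φ).unique ?_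
  rw [map_sum]
  simp only [map_smul, smul_eq_mul]
  refine hasSum_sum_of_ne_finset_zero fun n hn => ?_
  obtain ⟨m, rfl⟩ := Nat.exists_eq_add_of_le (not_lt.mp fun h' => hn (Finset.mem_range.mpr h'))
  rw [add_comm, pow_add, Module.End.mul_apply, h]
  simp

omit [FiniteDimensional ℂ V] in
lemma pow_apply_of_apply_eq_smul {A : Module.End ℂ V} {u : V} {c : ℂ} (h : A u = c • u) (n : ℕ) :
    (A ^ n) u = c ^ n • u := by
  induction n with
  | zero => simp
  | succ n ih => rw [pow_succ', Module.End.mul_apply, ih, map_smul, h, smul_smul, pow_succ]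

lemma expEnd_apply_of_apply_eq_smul {A : Module.End ℂ V} {u : V} {c : ℂ} (h : A u = c • u) :
    expEnd A u = Complex.exp c • u := by
  refine eq_of_forall_linearMap_eq fun φ => (hasSum_expEnd_apply A u φ).unique ?_
  have hc := (NormedSpace.exp_series_hasSum_exp' (𝕂 := ℂ) c).mul_right (φ u)
  rw [← Complex.exp_eq_exp_ℂ] at hc
  simpa [pow_apply_of_apply_eq_smul h, mul_assoc] using hc

lemma expEnd_apply_of_apply_eq_zero {A : Module.End ℂ V} {u : V} (h : A u = 0) :
    expEnd A u = u := by
  rw [expEnd_apply_of_apply_eq_smul (c := 0) (by rw [h, zero_smul]), Complex.exp_zero, one_smul]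

lemma expEnd_zero : expEnd (0 : Module.End ℂ V) = 1 :=
  LinearMap.ext fun _ => expEnd_apply_of_apply_eq_zero rfl

lemma expEnd_mul_expEnd_neg (A : Module.End ℂ V) : expEnd A * expEnd (-A) = 1 := by
  rw [← expEnd_add_of_commute (Commute.refl A).neg_right, add_neg_cancel, expEnd_zero]

lemma expEnd_neg_mul_expEnd (A : Module.End ℂ V) : expEnd (-A) * expEnd A = 1 := by
  simpa using expEnd_mul_expEnd_neg (-A)

lemma expEnd_mulLeft (A X : Module.End ℂ V) : expEnd (LinearMap.mulLeft ℂ A) X = expEnd A * X := by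
  refine eq_of_forall_linearMap_eq fun φ =>
    (hasSum_expEnd_apply (LinearMap.mulLeft ℂ A) X φ).unique ?_
  simpa using hasSum_expEnd A (φ ∘ₗ LinearMap.mulRight ℂ X)

lemma expEnd_mulRight (A X : Module.End ℂ V) :
    expEnd (LinearMap.mulRight ℂ A) X = X * expEnd A := by
  refine eq_of_forall_linearMap_eq fun φ =>
    (hasSum_expEnd_apply (LinearMap.mulRight ℂ A) X φ).unique ?_
  simpa using hasSum_expEnd A (φ ∘ₗ LinearMap.mulLeft ℂ X)

/-- Left and right multiplications commute, so the exponential of their difference factors. -/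
lemma expEnd_mul_mul_expEnd_neg (A X : Module.End ℂ V) :
    expEnd A * X * expEnd (-A) = expEnd (LinearMap.mulLeft ℂ A - LinearMap.mulRight ℂ A) X := by
  have h1 : LinearMap.mulLeft ℂ A - LinearMap.mulRight ℂ A =
      LinearMap.mulLeft ℂ A + LinearMap.mulRight ℂ (-A) := by
    ext X u; simp [sub_eq_add_neg]
  rw [h1, expEnd_add_of_commute (LinearMap.commute_mulLeft_right A (-A)), Module.End.mul_apply,
    expEnd_mulRight, expEnd_mulLeft, mul_assoc]

end Exp

/-! ### The adjoint action of the group on the Lie algebra. -/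

section Ad

variable {𝔤 : Type*} [LieRing 𝔤] [LieAlgebra ℂ 𝔤] [FiniteDimensional ℂ 𝔤]
  {V : Type*} [AddCommGroup V] [Module ℂ V] [FiniteDimensional ℂ V]
  [LieRingModule 𝔤 V] [LieModule ℂ 𝔤 V]

lemma expEnd_toEnd_mul_mul (x y : 𝔤) :
    expEnd (LieModule.toEnd ℂ 𝔤 V x) * LieModule.toEnd ℂ 𝔤 V y *
      expEnd (-LieModule.toEnd ℂ 𝔤 V x) =
      LieModule.toEnd ℂ 𝔤 V (expEnd (LieAlgebra.ad ℂ 𝔤 x) y) := by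
  rw [expEnd_mul_mul_expEnd_neg]
  refine eq_of_forall_linearMap_eq fun φ => (hasSum_expEnd_apply _ _ φ).unique ?_
  have key (n : ℕ) : ((LinearMap.mulLeft ℂ (LieModule.toEnd ℂ 𝔤 V x) -
      LinearMap.mulRight ℂ (LieModule.toEnd ℂ 𝔤 V x)) ^ n) (LieModule.toEnd ℂ 𝔤 V y) =
      LieModule.toEnd ℂ 𝔤 V ((LieAlgebra.ad ℂ 𝔤 x ^ n) y) := by
    induction n with
    | zero => simp
    | succ n ih =>
      rw [pow_succ', Module.End.mul_apply, ih, pow_succ', Module.End.mul_apply,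
        LieAlgebra.ad_apply]
      ext u
      simp
  simp only [key]
  exact hasSum_expEnd_apply (LieAlgebra.ad ℂ 𝔤 x) y
    { toFun := fun z => φ (LieModule.toEnd ℂ 𝔤 V z)
      map_add' := fun z w => by rw [map_add, map_add]
      map_smul' := fun c z => by rw [map_smul, map_smul, RingHom.id_apply] }

variable (V) in
/-- The exponential of an element of the Lie algebra, as an element of the group. -/
def expGroup (x : 𝔤) : group 𝔤 V :=
  ⟨LinearEquiv.ofLinearMap (expEnd (LieModule.toEnd ℂ 𝔤 V x))
    (expEnd (-LieModule.toEnd ℂ 𝔤 V x)) (expEnd_mul_expEnd_neg _) (expEnd_neg_mul_expEnd _),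
    Subgroup.subset_closure ⟨x, rfl⟩⟩

omit [FiniteDimensional ℂ 𝔤] in
lemma expGroup_apply (x : 𝔤) (u : V) :
    (expGroup V x : V ≃ₗ[ℂ] V) u = expEnd (LieModule.toEnd ℂ 𝔤 V x) u := rfl

lemma isAd_expGroup (x y : 𝔤) : IsAd (expGroup V x) y (expEnd (LieAlgebra.ad ℂ 𝔤 x) y) := by
  intro u
  have h := congrArg (fun A : Module.End ℂ V => A (expEnd (LieModule.toEnd ℂ 𝔤 V x) u))
    (expEnd_toEnd_mul_mul (V := V) x y)
  have h' := congrArg (fun A : Module.End ℂ V => A u)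
    (expEnd_neg_mul_expEnd (LieModule.toEnd ℂ 𝔤 V x))
  simp only [Module.End.mul_apply, Module.End.one_apply] at h h'
  rw [h'] at h
  exact h.symm

omit [FiniteDimensional ℂ 𝔤] in
lemma IsAd.mul {g g' : group 𝔤 V} {x y z : 𝔤} (h : IsAd g x y) (h' : IsAd g' y z) :
    IsAd (g' * g) x z := fun u => by
  change ⁅z, (g' : V ≃ₗ[ℂ] V) ((g : V ≃ₗ[ℂ] V) u)⁆ = (g' : V ≃ₗ[ℂ] V) ((g : V ≃ₗ[ℂ] V) ⁅x, u⁆)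
  rw [h' _, h _]

omit [FiniteDimensional ℂ 𝔤] in
lemma isAd_one (x : 𝔤) : IsAd (1 : group 𝔤 V) x x := fun _ => rfl

omit [FiniteDimensional ℂ 𝔤] in
lemma IsAd.inv {g : group 𝔤 V} {x y : 𝔤} (h : IsAd g x y) : IsAd g⁻¹ y x := fun u => by
  change ⁅x, (g : V ≃ₗ[ℂ] V).symm u⁆ = (g : V ≃ₗ[ℂ] V).symm ⁅y, u⁆
  rw [LinearEquiv.eq_symm_apply, ← h, LinearEquiv.apply_symm_apply]

omit [FiniteDimensional ℂ 𝔤] in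
lemma IsAd.add {g : group 𝔤 V} {x y x' y' : 𝔤} (h : IsAd g x y) (h' : IsAd g x' y') :
    IsAd g (x + x') (y + y') := fun u => by
  rw [add_lie, add_lie, h, h', map_add]

omit [FiniteDimensional ℂ 𝔤] in
lemma IsAd.smul {g : group 𝔤 V} {x y : 𝔤} (c : ℂ) (h : IsAd g x y) :
    IsAd g (c • x) (c • y) := fun u => by
  rw [smul_lie, smul_lie, h, map_smul]

omit [FiniteDimensional ℂ 𝔤] in
lemma IsAd.sub {g : group 𝔤 V} {x y x' y' : 𝔤} (h : IsAd g x y) (h' : IsAd g x' y') :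
    IsAd g (x - x') (y - y') := fun u => by
  rw [sub_lie, sub_lie, h, h', map_sub]

omit [FiniteDimensional ℂ 𝔤] in
lemma IsAd.sum {g : group 𝔤 V} {ι : Type*} (s : Finset ι) {x y : ι → 𝔤}
    (h : ∀ i ∈ s, IsAd g (x i) (y i)) : IsAd g (∑ i ∈ s, x i) (∑ i ∈ s, y i) := fun u => by
  rw [← LieModule.toEnd_apply_apply ℂ, ← LieModule.toEnd_apply_apply ℂ, map_sum, map_sum,
    LinearMap.sum_apply, LinearMap.sum_apply, map_sum]
  exact Finset.sum_congr rfl fun i hi => h i hi u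

lemma exists_isAd (g : group 𝔤 V) (x : 𝔤) : ∃ y, IsAd g x y := by
  obtain ⟨g, hg⟩ := g
  -- The claim for g and its inverse together, so that the induction passes through inverses.
  suffices ∀ x : 𝔤, (∃ y : 𝔤, ∀ u : V, ⁅y, g u⁆ = g ⁅x, u⁆) ∧
      ∃ y : 𝔤, ∀ u : V, ⁅y, g⁻¹ u⁆ = g⁻¹ ⁅x, u⁆ from (this x).1
  induction hg using Subgroup.closure_induction with
  | mem g hg =>
    obtain ⟨z, hz⟩ := hg
    have hz' : g = (expGroup V z : V ≃ₗ[ℂ] V) := LinearEquiv.toLinearMap_injective hz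
    subst hz'
    intro x
    refine ⟨⟨_, isAd_expGroup z x⟩, expEnd (LieAlgebra.ad ℂ 𝔤 (-z)) x, fun u => ?_⟩
    rw [LinearEquiv.coe_inv, LinearEquiv.eq_symm_apply]
    have h := isAd_expGroup (V := V) z (expEnd (LieAlgebra.ad ℂ 𝔤 (-z)) x)
      ((expGroup V z : V ≃ₗ[ℂ] V).symm u)
    rw [LinearEquiv.apply_symm_apply] at h
    rw [← h, map_neg, ← Module.End.mul_apply, expEnd_mul_expEnd_neg, Module.End.one_apply]
  | one => exact fun x => ⟨⟨x, fun _ => rfl⟩, ⟨x, fun _ => rfl⟩⟩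
  | mul g g' _ _ hg hg' =>
    intro x
    constructor
    · obtain ⟨y, hy⟩ := (hg' x).1
      obtain ⟨z, hz⟩ := (hg y).1
      exact ⟨z, fun u => by rw [LinearEquiv.mul_apply, LinearEquiv.mul_apply, hz, hy]⟩
    · obtain ⟨y, hy⟩ := (hg x).2
      obtain ⟨z, hz⟩ := (hg' y).2
      exact ⟨z, fun u => by rw [mul_inv_rev, LinearEquiv.mul_apply, LinearEquiv.mul_apply, hz, hy]⟩
  | inv g _ hg => exact fun x => ⟨(hg x).2, by simpa using (hg x).1⟩

end Ad

end HermitianSymmetric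

/-! ### The grading of the Lie algebra defined by a cominuscule simple root -/

namespace RootPairing.Base

variable {ι R M N : Type*} [Field R] [CharZero R] [AddCommGroup M] [Module R M]
  [AddCommGroup N] [Module R N] {P : RootPairing ι R M N} [P.IsRootSystem] (b : P.Base)

lemma height_eq_sum_of_repr {i : ι} {n : b.support → ℤ}
    (hn : ∀ a, b.toWeightBasis.repr (P.root i) a = n a) : b.height i = ∑ a, n a := by
  classical
  let f : ι → ℤ := fun j => if hj : j ∈ b.support then n ⟨j, hj⟩ else 0
  have hf : P.root i = ∑ j ∈ b.support, f j • P.root j := by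
    rw [← Finset.sum_coe_sort, ← b.toWeightBasis.sum_repr (P.root i)]
    refine Finset.sum_congr rfl fun a _ => ?_
    simp [hn, f, Int.cast_smul_eq_zsmul]
  rw [height_eq_sum hf, ← Finset.sum_coe_sort]
  exact Finset.sum_congr rfl fun a _ => by simp [f]

lemma isPos_iff_root_mem {i : ι} :
    b.IsPos i ↔ P.root i ∈ AddSubmonoid.closure (P.root '' b.support) := by
  constructor
  · intro h
    refine (b.root_mem_or_neg_mem i).resolve_right fun h' => ?_
    obtain ⟨n, hn⟩ := b.exists_nat_repr_eq h'
    have h1 := b.height_eq_sum_of_repr (i := i) (n := fun a => -(n a : ℤ)) fun a => by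
      have := hn a
      rw [map_neg, Finsupp.neg_apply] at this
      push_cast
      rw [← this, neg_neg]
    rw [isPos_iff, h1, Finset.sum_neg_distrib] at h
    have : 0 ≤ ∑ a, (n a : ℤ) := Finset.sum_nonneg fun a _ => by positivity
    lia
  · intro h
    obtain ⟨n, hn⟩ := b.exists_nat_repr_eq h
    rw [isPos_iff', b.height_eq_sum_of_repr (i := i) (n := fun a => (n a : ℤ)) fun a => by
      simpa using hn a]
    exact Finset.sum_nonneg fun a _ => by positivity

end RootPairing.Base

namespace HermitianSymmetric

open LieAlgebra LieAlgebra.IsKilling LieModule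

variable {𝔤 : Type*} [LieRing 𝔤] [LieAlgebra ℂ 𝔤] [FiniteDimensional ℂ 𝔤]
  [LieAlgebra.IsKilling ℂ 𝔤] {H : LieSubalgebra ℂ 𝔤} [H.IsCartanSubalgebra]

section General

lemma lie_induction {p : 𝔤 → Prop} (cartan : ∀ h ∈ H, p h)
    (root : ∀ β : H.root, ∀ x ∈ rootSpace H β.1, p x) (add : ∀ x y, p x → p y → p (x + y))
    (x : 𝔤) : p x := by
  have hx : x ∈ ⨆ β : Weight ℂ H 𝔤, rootSpace H β := by
    rw [LieModule.iSup_genWeightSpace_eq_top' ℂ H 𝔤]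
    exact LieSubmodule.mem_top _
  induction hx using LieSubmodule.iSup_induction' with
  | mem β x hx =>
    by_cases hβ : β.IsZero
    · rw [hβ.eq, rootSpace_zero_eq] at hx
      exact cartan x hx
    · exact root ⟨β, by simpa using hβ⟩ x hx
  | zero => exact cartan 0 H.zero_mem
  | add x y _ _ hx hy => exact add x y hx hy

lemma cartan_lie_of_mem_rootSpace {β : H → ℂ} {x : 𝔤} (hx : x ∈ rootSpace H β) (h : H) :
    ⁅(h : 𝔤), x⁆ = β h • x :=
  lie_eq_smul_of_mem_rootSpace hx h

lemma cartan_lie_cartan (h h' : H) : ⁅(h : 𝔤), (h' : 𝔤)⁆ = 0 := by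
  have : ⁅h, h'⁆ = 0 := trivial_lie_zero H H h h'
  exact congrArg Subtype.val this

lemma exists_eq_smul_of_mem_rootSpace {β : H.root} {x y : 𝔤} (hx : x ∈ rootSpace H β.1)
    (hx0 : x ≠ 0) (hy : y ∈ rootSpace H β.1) : ∃ c : ℂ, y = c • x := by
  obtain ⟨c, hc⟩ := (finrank_eq_one_iff_of_nonzero' (⟨x, hx⟩ : rootSpace H β.1)
    (by simpa [LieSubmodule.mk_eq_zero] using hx0)).mp
    (finrank_rootSpace_eq_one β.1 (LieSubalgebra.isNonZero_coe_root β)) ⟨y, hy⟩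
  exact ⟨c, by simpa using (congrArg Subtype.val hc).symm⟩

lemma exists_isSl2Triple {β : H.root} {e : 𝔤} (he : e ∈ rootSpace H β.1) (he0 : e ≠ 0) :
    ∃ f ∈ rootSpace H (-β.1 : H → ℂ), IsSl2Triple ((rootSystem H).coroot β : 𝔤) e f := by
  have hβ : β.1.IsNonZero := LieSubalgebra.isNonZero_coe_root β
  obtain ⟨h, e', f', ht, he', hf'⟩ := exists_isSl2Triple_of_weight_isNonZero hβ
  obtain ⟨c, rfl⟩ := exists_eq_smul_of_mem_rootSpace he' ht.e_ne_zero he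
  have hc : c ≠ 0 := by rintro rfl; simp at he0
  have hh := ht.h_eq_coroot hβ he' hf'
  refine ⟨c⁻¹ • f', (rootSpace H _).smul_mem _ hf', ?_⟩
  rw [rootSystem_coroot_apply, ← hh]
  exact ⟨ht.h_ne_zero, by rw [smul_lie, lie_smul, smul_smul, mul_inv_cancel₀ hc, one_smul,
    ht.lie_e_f], by rw [lie_smul, ht.lie_h_e_nsmul, smul_comm], by
      rw [lie_smul, ht.lie_h_f_nsmul, smul_neg, smul_comm]⟩

lemma rootSpace_eq_bot_of_notMem {β : Module.Dual ℂ H} (h0 : β ≠ 0)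
    (hβ : β ∉ Set.range (rootSystem H).root) : rootSpace H (β : H → ℂ) = ⊥ := by
  by_contra hne
  have hnz : (⟨β, hne⟩ : Weight ℂ H 𝔤).IsNonZero := by
    intro h
    exact h0 (by ext x; exact congrFun h x)
  exact hβ ⟨⟨⟨β, hne⟩, by simpa using hnz⟩, by ext x; rfl⟩

lemma lie_mem_rootSpace_add {β δ : H → ℂ} {x y : 𝔤} (hx : x ∈ rootSpace H β)
    (hy : y ∈ rootSpace H δ) : ⁅x, y⁆ ∈ rootSpace H (β + δ) :=
  lie_mem_genWeightSpace_of_mem_genWeightSpace hx hy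

lemma killingForm_lie_apply (x y z : 𝔤) :
    killingForm ℂ 𝔤 ⁅x, y⁆ z = killingForm ℂ 𝔤 x ⁅y, z⁆ :=
  traceForm_apply_lie_apply ℂ 𝔤 𝔤 x y z

lemma killingForm_lie_left (x y z : 𝔤) :
    killingForm ℂ 𝔤 ⁅x, y⁆ z = -killingForm ℂ 𝔤 y ⁅x, z⁆ := by
  rw [← lie_skew, map_neg, LinearMap.neg_apply, killingForm_lie_apply]

lemma eq_zero_of_killingForm_eq_zero {x : 𝔤} (h : ∀ y, killingForm ℂ 𝔤 y x = 0) : x = 0 := by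
  have : x ∈ LinearMap.ker (killingForm ℂ 𝔤) := by
    rw [LinearMap.mem_ker]
    ext y
    exact (LieModule.traceForm_comm ℂ 𝔤 𝔤 x y).trans (h y)
  rwa [ker_killingForm_eq_bot, Submodule.mem_bot] at this

end General

variable (b : (rootSystem H).Base) (γ : b.support)

/-- The coefficient of the simple root `γ`, as a linear functional. -/
def degree : Module.Dual ℂ H →ₗ[ℂ] ℂ := b.toWeightBasis.coord γ

lemma simpleCoeff_eq_degree (β : H.root) :
    simpleCoeff b γ β = degree b γ ((rootSystem H).root β) := rfl

/-- The element of the Cartan subalgebra on which a root takes the value of its coefficient at the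
simple root `γ`. -/
def gradingElement : H := (Module.evalEquiv ℂ H).symm (degree b γ)

lemma apply_gradingElement (φ : Module.Dual ℂ H) : φ (gradingElement b γ) = degree b γ φ :=
  Module.apply_evalEquiv_symm_apply ℂ H φ _

lemma root_apply_gradingElement (β : H.root) : β.1 (gradingElement b γ) = simpleCoeff b γ β :=
  apply_gradingElement b γ ((rootSystem H).root β)

lemma degree_self : degree b γ ((rootSystem H).root γ) = 1 := by
  simp only [degree, Module.Basis.coord_apply]
  rw [RootPairing.Base.toWeightBasis_repr_root]
  simp

lemma degree_of_ne {a : b.support} (ha : a ≠ γ) : degree b γ ((rootSystem H).root a) = 0 := by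
  simp only [degree, Module.Basis.coord_apply]
  rw [RootPairing.Base.toWeightBasis_repr_root]
  simp [ha]

variable {b γ} (hγ : IsCominuscule b γ)

include hγ in
lemma mem_noncompactPos_iff {β : H.root} : β ∈ noncompactPos b γ ↔ simpleCoeff b γ β = 1 := by
  constructor
  · rintro ⟨hpos, hne⟩
    rw [RootPairing.Base.isPos_iff_root_mem] at hpos
    obtain ⟨n, hn⟩ := b.exists_nat_repr_eq hpos
    rcases hγ β with h | h | h
    · have h' : (n γ : ℂ) = -1 := (hn γ).symm.trans h
      have : ((n γ + 1 : ℕ) : ℂ) = 0 := by push_cast; rw [h']; ring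
      exact absurd (Nat.cast_eq_zero.mp this) (Nat.succ_ne_zero _)
    · exact absurd h hne
    · exact h
  · intro h
    refine ⟨?_, by rw [h]; exact one_ne_zero⟩
    rw [RootPairing.Base.isPos_iff_root_mem]
    refine (b.root_mem_or_neg_mem β).resolve_right fun h' => ?_
    obtain ⟨n, hn⟩ := b.exists_nat_repr_eq h'
    have h' : -simpleCoeff b γ β = n γ := by
      rw [← hn, map_neg]; rfl
    rw [h] at h'
    have : ((n γ + 1 : ℕ) : ℂ) = 0 := by push_cast; rw [← h']; ring
    exact absurd (Nat.cast_eq_zero.mp this) (Nat.succ_ne_zero _)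

variable (b γ)

/-- The projection of the Lie algebra onto its part of degree one. -/
def projOne : 𝔤 →ₗ[ℂ] 𝔤 :=
  (2⁻¹ : ℂ) • (ad ℂ 𝔤 (gradingElement b γ) ∘ₗ ad ℂ 𝔤 (gradingElement b γ) +
    ad ℂ 𝔤 (gradingElement b γ))

variable {b γ}

lemma projOne_apply (x : 𝔤) : projOne b γ x = (2⁻¹ : ℂ) •
    (⁅(gradingElement b γ : 𝔤), ⁅(gradingElement b γ : 𝔤), x⁆⁆ +
      ⁅(gradingElement b γ : 𝔤), x⁆) := rfl

lemma projOne_of_lie_eq_smul {x : 𝔤} {c : ℂ} (h : ⁅(gradingElement b γ : 𝔤), x⁆ = c • x) :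
    projOne b γ x = (2⁻¹ * (c * c + c)) • x := by
  rw [projOne_apply, h, lie_smul, h, smul_smul, ← add_smul, smul_smul]

lemma projOne_of_lie_eq_self {x : 𝔤} (h : ⁅(gradingElement b γ : 𝔤), x⁆ = x) :
    projOne b γ x = x := by
  rw [projOne_of_lie_eq_smul (c := 1) (by rw [h, one_smul])]
  norm_num

lemma projOne_of_lie_eq_zero {x : 𝔤} (h : ⁅(gradingElement b γ : 𝔤), x⁆ = 0) :
    projOne b γ x = 0 := by
  rw [projOne_of_lie_eq_smul (c := 0) (by rw [h, zero_smul])]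
  norm_num

lemma lie_gradingElement_of_mem_rootSpace {β : H.root} {x : 𝔤} (hx : x ∈ rootSpace H β.1) :
    ⁅(gradingElement b γ : 𝔤), x⁆ = simpleCoeff b γ β • x := by
  rw [cartan_lie_of_mem_rootSpace hx, root_apply_gradingElement]

include hγ

/-- The polynomial (t² + t)/2 takes the values 0, 0, 1 at the only eigenvalues -1, 0, 1 of ad Z. -/
lemma lie_projOne (x : 𝔤) : ⁅(gradingElement b γ : 𝔤), projOne b γ x⁆ = projOne b γ x := by
  induction x using lie_induction (H := H) with
  | cartan h hh =>
    rw [projOne_of_lie_eq_zero (cartan_lie_cartan _ ⟨h, hh⟩), lie_zero]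
  | root β x hx =>
    have h := lie_gradingElement_of_mem_rootSpace (b := b) (γ := γ) hx
    rw [projOne_of_lie_eq_smul h, lie_smul, h, smul_smul]
    congr 1
    rcases hγ β with h | h | h <;> rw [h] <;> norm_num
  | add x y hx hy => rw [map_add, lie_add, hx, hy]

lemma projOne_eq_zero_of_mem_parabolic {x : 𝔤} (hx : x ∈ parabolic b γ) : projOne b γ x = 0 := by
  suffices parabolic b γ ≤ LinearMap.ker (projOne b γ) from this hx
  refine sup_le (fun h hh => projOne_of_lie_eq_zero (cartan_lie_cartan _ ⟨h, hh⟩)) ?_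
  refine iSup_le fun β x hx => ?_
  have hβ := β.2
  rw [mem_noncompactPos_iff hγ] at hβ
  rw [LinearMap.mem_ker, projOne_of_lie_eq_smul (lie_gradingElement_of_mem_rootSpace hx)]
  rcases hγ β.1 with h | h | h
  · rw [h]; norm_num
  · rw [h]; norm_num
  · exact absurd h hβ

lemma sub_projOne_mem_parabolic (x : 𝔤) : x - projOne b γ x ∈ parabolic b γ := by
  induction x using lie_induction (H := H) with
  | cartan h hh =>
    rw [projOne_of_lie_eq_zero (cartan_lie_cartan _ ⟨h, hh⟩), sub_zero]
    exact Submodule.mem_sup_left hh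
  | root β x hx =>
    by_cases hβ : β ∈ noncompactPos b γ
    · have h := lie_gradingElement_of_mem_rootSpace (b := b) (γ := γ) hx
      rw [(mem_noncompactPos_iff hγ).mp hβ, one_smul] at h
      rw [projOne_of_lie_eq_self h, sub_self]
      exact Submodule.zero_mem _
    · have hx' : x ∈ parabolic b γ := Submodule.mem_sup_right <|
        Submodule.mem_iSup_of_mem (⟨β, hβ⟩ : {β : H.root // β ∉ noncompactPos b γ}) hx
      rw [projOne_eq_zero_of_mem_parabolic hγ hx', sub_zero]
      exact hx'
  | add x y hx hy =>
    rw [map_add, add_sub_add_comm]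
    exact Submodule.add_mem _ hx hy

lemma mem_parabolic_iff {x : 𝔤} : x ∈ parabolic b γ ↔ projOne b γ x = 0 :=
  ⟨projOne_eq_zero_of_mem_parabolic hγ, fun h => by
    have := sub_projOne_mem_parabolic hγ x
    rwa [h, sub_zero] at this⟩

lemma mkQ_eq_mkQ_iff {x y : 𝔤} :
    (parabolic b γ).mkQ x = (parabolic b γ).mkQ y ↔ projOne b γ x = projOne b γ y := by
  rw [Submodule.mkQ_apply, Submodule.mkQ_apply, Submodule.Quotient.eq, mem_parabolic_iff hγ,
    map_sub, sub_eq_zero]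

lemma projOne_projOne (x : 𝔤) : projOne b γ (projOne b γ x) = projOne b γ x :=
  projOne_of_lie_eq_self (lie_projOne hγ x)

lemma mkQ_projOne (x : 𝔤) : (parabolic b γ).mkQ (projOne b γ x) = (parabolic b γ).mkQ x :=
  (mkQ_eq_mkQ_iff hγ).mpr (projOne_projOne hγ x)

/-- Elements of degree one commute. -/
lemma lie_eq_zero_of_degree_one {x y : 𝔤} (hx : ⁅(gradingElement b γ : 𝔤), x⁆ = x)
    (hy : ⁅(gradingElement b γ : 𝔤), y⁆ = y) : ⁅x, y⁆ = 0 := by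
  -- The bracket has degree two, where `projOne` is multiplication by 3; since its image has degree
  -- one, 6 and 3 times the bracket agree.
  have h2 : ⁅(gradingElement b γ : 𝔤), ⁅x, y⁆⁆ = (2 : ℂ) • ⁅x, y⁆ := by
    rw [leibniz_lie, hx, hy, two_smul]
  have h := lie_projOne hγ ⁅x, y⁆
  rw [projOne_of_lie_eq_smul h2, lie_smul, h2, smul_smul] at h
  have h' : (3 : ℂ) • ⁅x, y⁆ = 0 := by
    rw [← sub_eq_zero, ← sub_smul] at h
    norm_num at h
    simp [h]
  simpa using h'

end HermitianSymmetric

/-! ### The action on the base vector -/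

namespace HermitianSymmetric

open LieAlgebra LieAlgebra.IsKilling LieModule

lemma pow_toEnd_apply_eq_zero_of_isSl2Triple {𝔤 V : Type*} [LieRing 𝔤] [LieAlgebra ℂ 𝔤]
    [AddCommGroup V] [Module ℂ V] [FiniteDimensional ℂ V] [LieRingModule 𝔤 V] [LieModule ℂ 𝔤 V]
    {h e f : 𝔤} (t : IsSl2Triple h e f) {u : V} {n : ℕ} (hf : ⁅f, u⁆ = 0)
    (hh : ⁅h, u⁆ = -(n : ℂ) • u) : ((toEnd ℂ 𝔤 V e) ^ (n + 1)) u = 0 := by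
  by_cases hu : u = 0
  · rw [hu, map_zero]
  have P : t.symm.HasPrimitiveVectorWith u (n : ℂ) :=
    { ne_zero := hu
      lie_h := by rw [neg_lie, hh, neg_smul, neg_neg]
      lie_e := hf }
  exact P.pow_toEnd_f_eq_zero_of_eq_nat rfl

variable {𝔤 : Type*} [LieRing 𝔤] [LieAlgebra ℂ 𝔤] [FiniteDimensional ℂ 𝔤]
  [LieAlgebra.IsKilling ℂ 𝔤] {H : LieSubalgebra ℂ 𝔤} [H.IsCartanSubalgebra]
  (b : (rootSystem H).Base) (γ : b.support)

/-- The weight of the base vector, the negative of the fundamental weight of `γ`. -/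
def baseWeight : H →ₗ[ℂ] ℂ := -b.toCoweightBasis.coord γ

lemma baseWeight_coroot_self : baseWeight b γ ((rootSystem H).coroot γ) = -1 := by
  simp only [baseWeight, LinearMap.neg_apply, Module.Basis.coord_apply]
  rw [RootPairing.Base.toCoweightBasis_repr_coroot]
  simp

lemma baseWeight_coroot_of_ne {a : b.support} (ha : a ≠ γ) :
    baseWeight b γ ((rootSystem H).coroot a) = 0 := by
  simp only [baseWeight, LinearMap.neg_apply, Module.Basis.coord_apply]
  rw [RootPairing.Base.toCoweightBasis_repr_coroot]
  simp [ha]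

variable {b γ} (hγ : IsCominuscule b γ)

include hγ in
lemma rootLength_mul_baseWeight (β : H.root) :
    (((rootSystem H).posRootForm ℤ).rootLength β : ℂ) *
      baseWeight b γ ((rootSystem H).coroot β) =
    -(simpleCoeff b γ β * ((rootSystem H).posRootForm ℤ).rootLength γ) := by
  -- The length formula needs only the grading, so the empty cascade serves.
  have hc : b.IsCascade (degree b γ) γ (Fin.elim0 : Fin 0 → H.root) :=
    { grading := hγ
      self := degree_self b γ
      simple := fun a ha => degree_of_ne b γ ha
      level := fun i => i.elim0
      highest := fun i => i.elim0 }
  have h := hc.rootLength_mul_apply_coroot (l := -baseWeight b γ)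
    (by rw [LinearMap.neg_apply, baseWeight_coroot_self, neg_neg])
    (fun a ha => by rw [LinearMap.neg_apply, baseWeight_coroot_of_ne b γ ha, neg_zero]) β
  rw [LinearMap.neg_apply, mul_neg] at h
  rw [← neg_eq_iff_eq_neg, h]
  rfl

include hγ in
lemma baseWeight_coroot_of_simpleCoeff_eq_zero {β : H.root} (hβ : simpleCoeff b γ β = 0) :
    baseWeight b γ ((rootSystem H).coroot β) = 0 := by
  have h := rootLength_mul_baseWeight hγ β
  rw [hβ, zero_mul, neg_zero] at h
  refine (mul_eq_zero.mp h).resolve_left ?_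
  exact_mod_cast (((rootSystem H).posRootForm ℤ).rootLength_pos β).ne'

variable {V : Type*} [AddCommGroup V] [Module ℂ V] [LieRingModule 𝔤 V] [LieModule ℂ 𝔤 V]
  {v : V} (hv : IsBaseVector b γ v)

include hv

lemma cartan_lie_base (h : H) : ⁅(h : 𝔤), v⁆ = baseWeight b γ h • v := by
  let F : H →ₗ[ℂ] V := (toEnd ℂ H V : H →ₗ[ℂ] Module.End ℂ V).flip v
  have hF (h : H) : F h = ⁅(h : 𝔤), v⁆ := rfl
  have : F = (baseWeight b γ).smulRight v := by
    refine b.toCoweightBasis.ext fun a => ?_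
    rw [RootPairing.Base.toCoweightBasis_apply, hF, LinearMap.smulRight_apply]
    by_cases ha : a = γ
    · subst ha
      rw [hv.weight_self, baseWeight_coroot_self, neg_smul, one_smul]
    · rw [hv.weight_other a a.2 fun h => ha (Subtype.ext h), baseWeight_coroot_of_ne b γ ha,
        zero_smul]
  rw [← hF, this, LinearMap.smulRight_apply]

variable [FiniteDimensional ℂ V]

include hγ in
-- Negative roots kill a lowest weight vector. For a positive root of degree zero the coroot has
-- weight 0 on v, so the 𝔰𝔩₂-string through v is trivial.
lemma lie_base_of_mem_rootSpace {β : H.root} (hβ : simpleCoeff b γ β ≠ 1) {x : 𝔤}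
    (hx : x ∈ rootSpace H β.1) : ⁅x, v⁆ = 0 := by
  by_cases hpos : b.IsPos β
  · have h0 : simpleCoeff b γ β = 0 := by
      by_contra hne
      exact hβ ((mem_noncompactPos_iff hγ).mp ⟨hpos, hne⟩)
    by_cases hx0 : x = 0
    · rw [hx0, zero_lie]
    obtain ⟨f, hf, t⟩ := exists_isSl2Triple hx hx0
    have := pow_toEnd_apply_eq_zero_of_isSl2Triple t (u := v) (n := 0) (hv.lowest β hpos f hf)
      (by rw [cartan_lie_base hv, baseWeight_coroot_of_simpleCoeff_eq_zero hγ h0]; simp)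
    simpa using this
  · have hneg := (RootPairing.Base.IsPos.or_neg b β).resolve_left hpos
    refine hv.lowest _ hneg x ?_
    convert hx using 2
    have h1 := (rootSystem H).root_reflectionPerm β β
    rw [RootPairing.reflection_apply_self] at h1
    ext h
    refine (congrArg (fun φ : Module.Dual ℂ H => -φ h) h1).trans ?_
    simp

lemma killingForm_gradingElement_of_mem_rootSpace {β : H.root} {x : 𝔤}
    (hx : x ∈ rootSpace H β.1) : killingForm ℂ 𝔤 (gradingElement b γ) x = 0 := by
  have hZ : (gradingElement b γ : 𝔤) ∈ rootSpace H (0 : H → ℂ) := by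
    rw [rootSpace_zero_eq]
    exact (gradingElement b γ).2
  refine killingForm_apply_eq_zero_of_mem_rootSpace_of_add_ne_zero ℂ 𝔤 H hZ hx ?_
  rw [zero_add]
  exact fun h => LieSubalgebra.isNonZero_coe_root β h

include hγ in
-- The character by which 𝔭 acts on the line of v is a multiple of the Killing form with Z: both
-- vanish on the root spaces of 𝔭 and are compared on simple coroots.
lemma exists_lie_base_of_mem_parabolic : ∃ c : ℂ, c ≠ 0 ∧ ∀ x ∈ parabolic b γ,
    ⁅x, v⁆ = (c * killingForm ℂ 𝔤 (gradingElement b γ) x) • v := by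
  set q := (γ : H.root).1 ((cartanEquivDual H).symm (γ : H.root).1) with hq
  have hq0 : q ≠ 0 :=
    root_apply_cartanEquivDual_symm_ne_zero (LieSubalgebra.isNonZero_coe_root (γ : H.root))
  -- The Killing form of Z and the coroot of a simple root a is 2 a(Z)/(a, a); with q = (γ, γ) this
  -- factor yields -1 at γ and 0 at the other simple roots.
  refine ⟨-(q / 2), by simpa using hq0, fun x hx => ?_⟩
  let F : 𝔤 →ₗ[ℂ] V := (toEnd ℂ 𝔤 V : 𝔤 →ₗ[ℂ] Module.End ℂ V).flip v
  have hF (x : 𝔤) : F x = ⁅x, v⁆ := rfl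
  suffices parabolic b γ ≤ LinearMap.ker
      (F - (-(q / 2) • killingForm ℂ 𝔤 (gradingElement b γ)).smulRight v) by
    have := this hx
    rw [LinearMap.mem_ker, LinearMap.sub_apply, sub_eq_zero] at this
    exact this
  refine sup_le (fun h hh => ?_) (iSup_le fun β x hx => ?_)
  · rw [LinearMap.mem_ker, LinearMap.sub_apply, sub_eq_zero, LinearMap.smulRight_apply, hF,
      cartan_lie_base hv ⟨h, hh⟩]
    congr 1
    have key : baseWeight b γ = -(q / 2) • (killingForm ℂ 𝔤 (gradingElement b γ)) ∘ₗ
        H.toSubmodule.subtype := by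
      refine b.toCoweightBasis.ext fun a => ?_
      rw [RootPairing.Base.toCoweightBasis_apply, rootSystem_coroot_apply]
      have h1 : killingForm ℂ 𝔤 (gradingElement b γ) (coroot (a : H.root).1 : 𝔤) =
          2 * (((a : H.root).1 ((cartanEquivDual H).symm (a : H.root).1))⁻¹ *
            simpleCoeff b γ a) := by
        rw [← root_apply_gradingElement]
        have := traceForm_coroot (a : H.root).1 (gradingElement b γ)
        rw [nsmul_eq_mul, smul_eq_mul] at this
        push_cast at this
        rw [← this, LieModule.traceForm_comm]
        rfl
      have h2 : ((-(q / 2)) • killingForm ℂ 𝔤 (gradingElement b γ) ∘ₗ H.toSubmodule.subtype)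
          (coroot (a : H.root).1) = -(q / 2) *
            killingForm ℂ 𝔤 (gradingElement b γ) (coroot (a : H.root).1 : 𝔤) := rfl
      rw [h2, h1, simpleCoeff_eq_degree]
      by_cases ha : a = γ
      · subst ha
        rw [degree_self, ← hq]
        have := baseWeight_coroot_self b a
        rw [rootSystem_coroot_apply] at this
        rw [this]
        field_simp
      · have := baseWeight_coroot_of_ne b γ ha
        rw [rootSystem_coroot_apply] at this
        rw [degree_of_ne b γ ha, this]
        ring
    rw [key]
    rfl
  · have hβ := β.2
    rw [mem_noncompactPos_iff hγ] at hβ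
    rw [LinearMap.mem_ker, LinearMap.sub_apply, sub_eq_zero, LinearMap.smulRight_apply, hF,
      lie_base_of_mem_rootSpace hγ hv hβ hx, LinearMap.smul_apply,
      killingForm_gradingElement_of_mem_rootSpace hv hx, smul_zero, zero_smul]

include hγ in
/-- The action of the part of degree `-1` on the part of degree one of the representation. -/
lemma exists_lie_lie_base : ∃ c : ℂ, c ≠ 0 ∧
    (∀ x ∈ parabolic b γ, ⁅x, v⁆ = (c * killingForm ℂ 𝔤 (gradingElement b γ) x) • v) ∧
    ∀ x y : 𝔤, ⁅(gradingElement b γ : 𝔤), x⁆ = x → ⁅(gradingElement b γ : 𝔤), y⁆ = -y →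
      ⁅y, ⁅x, v⁆⁆ = -(c * killingForm ℂ 𝔤 y x) • v := by
  obtain ⟨c, hc, h⟩ := exists_lie_base_of_mem_parabolic hγ hv
  refine ⟨c, hc, h, fun x y hx hy => ?_⟩
  have hyp : y ∈ parabolic b γ := by
    rw [mem_parabolic_iff hγ, projOne_of_lie_eq_smul (c := -1) (by rw [hy, neg_one_smul])]
    norm_num
  have hyv : ⁅y, v⁆ = 0 := by
    have h0 : killingForm ℂ 𝔤 (gradingElement b γ) y = 0 := by
      have h1 := killingForm_lie_apply (gradingElement b γ : 𝔤) (gradingElement b γ : 𝔤) y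
      rw [lie_self, map_zero, LinearMap.zero_apply, hy, map_neg] at h1
      exact neg_eq_zero.mp h1.symm
    rw [h y hyp, h0, mul_zero, zero_smul]
  have hyx : ⁅y, x⁆ ∈ parabolic b γ := by
    rw [mem_parabolic_iff hγ]
    refine projOne_of_lie_eq_zero ?_
    rw [leibniz_lie, hx, hy, neg_lie, neg_add_cancel]
  -- As y kills v, only [y, x] v is left; by invariance the Killing form of Z and [y, x] is minus
  -- that of y and x.
  rw [leibniz_lie, hyv, lie_zero, add_zero, h _ hyx, ← killingForm_lie_apply, hy, map_neg,
    LinearMap.neg_apply, mul_neg]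

include hγ in
-- Acting on x v by elements of degree -1 recovers the Killing form with x, and degrees 0 and 1 are
-- orthogonal to x anyway; nondegeneracy concludes.
lemma eq_zero_of_lie_base_eq_zero {x : 𝔤} (hx : ⁅(gradingElement b γ : 𝔤), x⁆ = x)
    (hxv : ⁅x, v⁆ = 0) : x = 0 := by
  obtain ⟨c, hc, -, h⟩ := exists_lie_lie_base hγ hv
  refine eq_zero_of_killingForm_eq_zero fun y => ?_
  induction y using lie_induction (H := H) with
  | cartan y hy =>
    rw [← hx, ← killingForm_lie_apply, cartan_lie_cartan ⟨y, hy⟩, map_zero, LinearMap.zero_apply]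
  | root β y hy =>
    have hZ := lie_gradingElement_of_mem_rootSpace (b := b) (γ := γ) hy
    have h1 := killingForm_lie_left (gradingElement b γ : 𝔤) y x
    rw [hx, hZ, map_smul, LinearMap.smul_apply, smul_eq_mul] at h1
    rcases hγ β with h' | h' | h'
    · rw [h', neg_one_smul] at hZ
      have h2 := h x y hx hZ
      rw [hxv, lie_zero] at h2
      have := (smul_eq_zero.mp h2.symm).resolve_right hv.ne_zero
      exact (mul_eq_zero.mp (neg_eq_zero.mp this)).resolve_left hc
    · rw [h', zero_mul] at h1
      exact neg_eq_zero.mp h1.symm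
    · rw [h', one_mul] at h1
      linear_combination (1 / 2 : ℂ) * h1
  | add y z hy hz => rw [map_add, LinearMap.add_apply, hy, hz, add_zero]

omit [FiniteDimensional ℂ V] in
lemma gradingElement_lie_base :
    ⁅(gradingElement b γ : 𝔤), v⁆ = baseWeight b γ (gradingElement b γ) • v :=
  cartan_lie_base hv _

omit [FiniteDimensional ℂ V] hv in
lemma gradingElement_lie_lie {x : 𝔤} {u : V} {c d : ℂ}
    (hx : ⁅(gradingElement b γ : 𝔤), x⁆ = d • x) (hu : ⁅(gradingElement b γ : 𝔤), u⁆ = c • u) :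
    ⁅(gradingElement b γ : 𝔤), ⁅x, u⁆⁆ = (c + d) • ⁅x, u⁆ := by
  rw [leibniz_lie, hx, hu, smul_lie, lie_smul, ← add_smul, add_comm]

include hγ in
/-- The parabolic subalgebra is the stabilizer of the base line. -/
lemma mem_parabolic_iff_lie_base {x : 𝔤} : x ∈ parabolic b γ ↔ ∃ c : ℂ, ⁅x, v⁆ = c • v := by
  constructor
  · intro hx
    obtain ⟨c, -, h⟩ := exists_lie_base_of_mem_parabolic hγ hv
    exact ⟨_, h x hx⟩
  · rintro ⟨c, hc⟩
    obtain ⟨d, -, h⟩ := exists_lie_base_of_mem_parabolic hγ hv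
    rw [mem_parabolic_iff hγ]
    have h1 := h _ (sub_projOne_mem_parabolic hγ x)
    set x' := projOne b γ x with hx'
    have hZx' : ⁅(gradingElement b γ : 𝔤), x'⁆ = x' := lie_projOne hγ x
    rw [sub_lie, hc, sub_eq_iff_eq_add', ← sub_eq_iff_eq_add, ← sub_smul] at h1
    set s := c - d * killingForm ℂ 𝔤 (gradingElement b γ) (x - x')
    -- The degree-one part sends v to a multiple of v whose Z-eigenvalue is one larger than that of
    -- v, hence to 0.
    have h2 := gradingElement_lie_lie (d := 1) (by rw [one_smul, hZx'])
      (gradingElement_lie_base hv)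
    rw [← h1, lie_smul, gradingElement_lie_base hv, smul_comm, ← sub_eq_zero, ← sub_smul] at h2
    have h3 : s • v = 0 := by simpa using h2
    exact eq_zero_of_lie_base_eq_zero hγ hv hZx' (h1.symm.trans h3)

end HermitianSymmetric

/-! ### The quadratic equations of the variety -/

namespace HermitianSymmetric

open LieAlgebra LieAlgebra.IsKilling LieModule

section Group

variable {𝔤 : Type*} [LieRing 𝔤] [LieAlgebra ℂ 𝔤] [FiniteDimensional ℂ 𝔤]
  {V : Type*} [AddCommGroup V] [Module ℂ V] [FiniteDimensional ℂ V]
  [LieRingModule 𝔤 V] [LieModule ℂ 𝔤 V]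

lemma mem_variety_iff {v u : V} (hv : v ≠ 0) (hu : u ≠ 0) :
    Projectivization.mk ℂ u hu ∈ variety 𝔤 (Projectivization.mk ℂ v hv) ↔
      ∃ g : group 𝔤 V, ∃ c : ℂ, c • u = (g : V ≃ₗ[ℂ] V) v := by
  refine exists_congr fun g => ?_
  exact Projectivization.mk_eq_mk_iff' ℂ ((g : V ≃ₗ[ℂ] V) v) u _ hu

lemma mem_parabolicGroup_iff {v : V} (hv : v ≠ 0) {g : group 𝔤 V} :
    g ∈ parabolicGroup 𝔤 (Projectivization.mk ℂ v hv) ↔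
      ∃ c : ℂ, c • v = (g : V ≃ₗ[ℂ] V) v :=
  Projectivization.mk_eq_mk_iff' ℂ ((g : V ≃ₗ[ℂ] V) v) v _ hv

lemma ne_zero_of_smul_eq {v : V} (hv : v ≠ 0) {g : group 𝔤 V} {c : ℂ} {u : V}
    (h : c • u = (g : V ≃ₗ[ℂ] V) v) : c ≠ 0 := by
  rintro rfl
  rw [zero_smul] at h
  exact hv ((g : V ≃ₗ[ℂ] V).map_eq_zero_iff.mp h.symm)

variable (hf : ∀ x : 𝔤, (∀ u : V, ⁅x, u⁆ = 0) → x = 0)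

include hf

lemma IsAd.unique {g : group 𝔤 V} {x y z : 𝔤} (hy : IsAd g x y) (hz : IsAd g x z) : y = z := by
  rw [← sub_eq_zero]
  refine hf _ fun u => ?_
  obtain ⟨w, rfl⟩ := (g : V ≃ₗ[ℂ] V).surjective u
  rw [sub_lie, hy w, hz w, sub_self]

lemma IsAd.lie {g : group 𝔤 V} {x x' y y' : 𝔤} (hx : IsAd g x x') (hy : IsAd g y y') :
    IsAd g ⁅x, y⁆ ⁅x', y'⁆ := fun u => by
  rw [lie_lie, hy, hx, hx, hy, ← map_sub, lie_lie]

/-- Faithfulness makes Ad(g) a well-defined automorphism of the Lie algebra, and automorphisms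
preserve the Killing form. -/
lemma IsAd.killingForm_eq {g : group 𝔤 V} {x x' y y' : 𝔤} (hx : IsAd g x x') (hy : IsAd g y y') :
    killingForm ℂ 𝔤 x' y' = killingForm ℂ 𝔤 x y := by
  choose F hF using exists_isAd (𝔤 := 𝔤) g
  choose G hG using exists_isAd (𝔤 := 𝔤) g⁻¹
  let E : 𝔤 ≃ₗ⁅ℂ⁆ 𝔤 :=
    { toFun := F
      map_add' := fun x y => (hF (x + y)).unique hf ((hF x).add (hF y))
      map_smul' := fun c x => (hF (c • x)).unique hf ((hF x).smul c)
      map_lie' := fun {x y} => (hF ⁅x, y⁆).unique hf ((hF x).lie hf (hF y))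
      invFun := G
      left_inv := fun x => (hG (F x)).unique hf (hF x).inv
      right_inv := fun x => by
        have h := (hG x).inv
        rw [inv_inv] at h
        exact (hF (G x)).unique hf h }
  have hEx : E x = x' := (hF x).unique hf hx
  have hEy : E y = y' := (hF y).unique hf hy
  rw [← hEx, ← hEy, killingForm_of_equiv_apply]

end Group

variable {𝔤 : Type*} [LieRing 𝔤] [LieAlgebra ℂ 𝔤] [FiniteDimensional ℂ 𝔤]
  [LieAlgebra.IsKilling ℂ 𝔤] {H : LieSubalgebra ℂ 𝔤} [H.IsCartanSubalgebra]
  {b : (rootSystem H).Base} {γ : b.support} (hγ : IsCominuscule b γ)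
  {V : Type*} [AddCommGroup V] [Module ℂ V] [LieRingModule 𝔤 V] [LieModule ℂ 𝔤 V]
  [FiniteDimensional ℂ V] {v : V} (hv : IsBaseVector b γ v)

include hγ hv

lemma IsAd.mem_parabolic {g : group 𝔤 V}
    (hg : g ∈ parabolicGroup 𝔤 (Projectivization.mk ℂ v hv.ne_zero)) {x y : 𝔤} (h : IsAd g x y)
    (hx : x ∈ parabolic b γ) : y ∈ parabolic b γ := by
  obtain ⟨c, hc⟩ := (mem_parabolicGroup_iff hv.ne_zero).mp hg
  obtain ⟨d, hd⟩ := (mem_parabolic_iff_lie_base hγ hv).mp hx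
  refine (mem_parabolic_iff_lie_base hγ hv).mpr ⟨d, ?_⟩
  have h1 := h v
  rw [← hc, hd, map_smul, ← hc, lie_smul, smul_comm] at h1
  exact smul_right_injective V (ne_zero_of_smul_eq hv.ne_zero hc) h1

/-- The quadratic equation of the base vector. -/
lemma lie_moment_base (ψ : V →ₗ[ℂ] ℂ) {μ : 𝔤} (hμ : ∀ x, killingForm ℂ 𝔤 μ x = ψ ⁅x, v⁆) {c : ℂ}
    (hc : ∀ x ∈ parabolic b γ, ⁅x, v⁆ = (c * killingForm ℂ 𝔤 (gradingElement b γ) x) • v) :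
    ⁅μ, v⁆ = (c * baseWeight b γ (gradingElement b γ) * ψ v) • v := by
  -- Degree -1 kills v, so μ is Killing-orthogonal to it and has no part of degree one. Thus μ lies
  -- in 𝔭 and acts on v by the known character.
  have hμ1 : projOne b γ μ = 0 := by
    refine eq_zero_of_killingForm_eq_zero fun y => ?_
    rw [LieModule.traceForm_comm]
    change killingForm ℂ 𝔤 (projOne b γ μ) y = 0
    set μ' := projOne b γ μ with hμ'
    have hZ : ⁅(gradingElement b γ : 𝔤), μ'⁆ = μ' := lie_projOne hγ μ
    induction y using lie_induction (H := H) with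
    | cartan y hy =>
      rw [← hZ, killingForm_lie_left, cartan_lie_cartan _ ⟨y, hy⟩, map_zero, neg_zero]
    | root β y hy =>
      have hZy := lie_gradingElement_of_mem_rootSpace (b := b) (γ := γ) hy
      have h1 := killingForm_lie_left (gradingElement b γ : 𝔤) μ' y
      rw [hZ, hZy, map_smul, smul_eq_mul] at h1
      rcases hγ β with h' | h' | h'
      · rw [h', neg_one_smul] at hZy
        have hyv : ⁅y, v⁆ = 0 := lie_base_of_mem_rootSpace hγ hv (by rw [h']; norm_num) hy
        have h2 : killingForm ℂ 𝔤 μ' y = killingForm ℂ 𝔤 μ y := by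
          rw [hμ', projOne_apply, map_smul, LinearMap.smul_apply, map_add, LinearMap.add_apply,
            killingForm_lie_left, killingForm_lie_left, killingForm_lie_left, hZy, lie_neg, hZy,
            map_neg, map_neg, smul_eq_mul]
          ring
        rw [h2, hμ, hyv, map_zero]
      · rw [h', zero_mul, neg_zero] at h1
        exact h1
      · rw [h', one_mul] at h1
        linear_combination (1 / 2 : ℂ) * h1
    | add y z hy hz => rw [map_add, hy, hz, add_zero]
  have h := hc μ ((mem_parabolic_iff hγ).mpr hμ1)
  have h1 : killingForm ℂ 𝔤 (gradingElement b γ) μ =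
      baseWeight b γ (gradingElement b γ) * ψ v := by
    have : killingForm ℂ 𝔤 (gradingElement b γ) μ = killingForm ℂ 𝔤 μ (gradingElement b γ) :=
      LieModule.traceForm_comm ℂ 𝔤 𝔤 _ _
    rw [this, hμ, gradingElement_lie_base hv, map_smul, smul_eq_mul]
  rw [h, h1, mul_assoc]

/-- The quadratic equations of the variety. -/
lemma lie_moment (hf : ∀ x : 𝔤, (∀ u : V, ⁅x, u⁆ = 0) → x = 0) {u : V} (hu : u ≠ 0)
    (hmem : Projectivization.mk ℂ u hu ∈ variety 𝔤 (Projectivization.mk ℂ v hv.ne_zero))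
    (ψ : V →ₗ[ℂ] ℂ) {μ : 𝔤} (hμ : ∀ x, killingForm ℂ 𝔤 μ x = ψ ⁅x, u⁆) {c : ℂ}
    (hc : ∀ x ∈ parabolic b γ, ⁅x, v⁆ = (c * killingForm ℂ 𝔤 (gradingElement b γ) x) • v) :
    ⁅μ, u⁆ = (c * baseWeight b γ (gradingElement b γ) * ψ u) • u := by
  obtain ⟨g, t, ht⟩ := (mem_variety_iff hv.ne_zero hu).mp hmem
  have ht0 := ne_zero_of_smul_eq hv.ne_zero ht
  -- Transport to the base point: μ' represents the functional of v and ψ ∘ g. The factor t accounts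
  -- for t u = g v.
  obtain ⟨μ', hμ'⟩ := exists_isAd g⁻¹ (t • μ)
  have hμ'' := hμ'.inv
  rw [inv_inv] at hμ''
  have key := lie_moment_base hγ hv (ψ ∘ₗ (g : V ≃ₗ[ℂ] V).toLinearMap) (μ := μ') (fun x => by
    obtain ⟨x', hx'⟩ := exists_isAd g x
    rw [← IsAd.killingForm_eq hf hμ'' hx', map_smul, LinearMap.smul_apply, hμ]
    rw [LinearMap.comp_apply, LinearEquiv.coe_coe, ← hx', ← ht, lie_smul, map_smul]) hc
  have h2 := congrArg (g : V ≃ₗ[ℂ] V) key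
  rw [← hμ'', map_smul, LinearMap.comp_apply, LinearEquiv.coe_coe, ← ht, smul_lie, lie_smul,
    map_smul, smul_eq_mul] at h2
  refine smul_right_injective V ht0 (smul_right_injective V ht0 ?_)
  change t • t • ⁅μ, u⁆ = t • t • _
  rw [h2, smul_smul, smul_smul, smul_smul]
  congr 1
  ring

/-- A tangent vector of degree one which is itself a point of the variety is a quadratic
nilpotent. -/
lemma lie_lie_base_eq_zero (hf : ∀ x : 𝔤, (∀ u : V, ⁅x, u⁆ = 0) → x = 0) {x : 𝔤}
    (hx : ⁅(gradingElement b γ : 𝔤), x⁆ = x) (hxv : ⁅x, v⁆ ≠ 0)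
    (hmem : Projectivization.mk ℂ ⁅x, v⁆ hxv ∈ variety 𝔤 (Projectivization.mk ℂ v hv.ne_zero)) :
    ⁅x, ⁅x, v⁆⁆ = 0 := by
  obtain ⟨c, hc, hpar, hm⟩ := exists_lie_lie_base hγ hv
  obtain ⟨ψ₀, hψ₀⟩ := Module.Projective.exists_dual_eq_one ℂ hv.ne_zero
  set z := baseWeight b γ (gradingElement b γ) with hz
  let T : Module.End ℂ V := toEnd ℂ 𝔤 V (gradingElement b γ)
  -- Lagrange interpolation in Z: ψ agrees with ψ₀ on the eigenvalue z of v and vanishes on z + 1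
  -- and z + 2.
  let ψ : V →ₗ[ℂ] ℂ := ψ₀ ∘ₗ ((2⁻¹ : ℂ) • ((T - (z + 1) • 1) * (T - (z + 2) • 1)))
  have hψ {u : V} {d : ℂ} (hu : ⁅(gradingElement b γ : 𝔤), u⁆ = (z + d) • u) :
      ψ u = 2⁻¹ * ((d - 1) * (d - 2)) * ψ₀ u := by
    have hT (e : ℂ) : (T - (z + e) • 1) u = (d - e) • u := by
      rw [LinearMap.sub_apply, LinearMap.smul_apply, Module.End.one_apply, toEnd_apply_apply, hu,
        ← sub_smul]
      congr 1
      ring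
    simp only [ψ, LinearMap.comp_apply, LinearMap.smul_apply, Module.End.mul_apply, hT, map_smul,
      smul_eq_mul]
    ring
  have hZv := gradingElement_lie_base hv
  have hZxv : ⁅(gradingElement b γ : 𝔤), ⁅x, v⁆⁆ = (z + 1) • ⁅x, v⁆ :=
    gradingElement_lie_lie (by rw [one_smul, hx]) hZv
  -- Only y of degree -1 brings x v back to the eigenvalue z, where y x v is -c times the Killing
  -- form of y and x, times v. So -c x represents ψ, and the equation at x v, on which ψ vanishes,
  -- reads -c x² v = 0.
  have hμ : ∀ y, killingForm ℂ 𝔤 (-c • x) y = ψ ⁅y, ⁅x, v⁆⁆ := by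
    intro y
    rw [map_smul, LinearMap.smul_apply, smul_eq_mul]
    induction y using lie_induction (H := H) with
    | cartan y hy =>
      have h0 : ⁅(gradingElement b γ : 𝔤), y⁆ = (0 : ℂ) • y := by
        rw [zero_smul, cartan_lie_cartan _ ⟨y, hy⟩]
      have h1 : killingForm ℂ 𝔤 x y = 0 := by
        rw [← hx, killingForm_lie_left, h0, zero_smul, map_zero, neg_zero]
      rw [h1, hψ (d := 1) (by rw [gradingElement_lie_lie h0 hZxv, add_zero])]
      ring
    | root β y hy =>
      have hZy := lie_gradingElement_of_mem_rootSpace (b := b) (γ := γ) hy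
      have h1 := killingForm_lie_left (gradingElement b γ : 𝔤) x y
      rw [hx, hZy, map_smul, smul_eq_mul] at h1
      rw [hψ (d := 1 + simpleCoeff b γ β) (by rw [gradingElement_lie_lie hZy hZxv, add_assoc])]
      rcases hγ β with h' | h' | h'
      · rw [h', neg_one_smul] at hZy
        have hcomm : killingForm ℂ 𝔤 y x = killingForm ℂ 𝔤 x y :=
          LieModule.traceForm_comm ℂ 𝔤 𝔤 _ _
        rw [h', hm x y hx hZy, map_smul, hψ₀, hcomm, smul_eq_mul]
        ring
      · rw [h', zero_mul, neg_zero] at h1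
        rw [h1, h']
        ring
      · have h2 : killingForm ℂ 𝔤 x y = 0 := by
          rw [h', one_mul] at h1
          linear_combination (1 / 2 : ℂ) * h1
        rw [h2, h']
        ring
    | add y y' hy hy' => rw [map_add, mul_add, hy, hy', add_lie, map_add]
  have key := lie_moment hγ hv hf hxv hmem ψ hμ hpar
  rw [hψ hZxv, sub_self, zero_mul, mul_zero, zero_mul, mul_zero, zero_smul, smul_lie] at key
  exact (smul_eq_zero.mp key).resolve_left (neg_ne_zero.mpr hc)

/-- The directions of the lines through the base point are quadratic nilpotents of degree one. -/
lemma exists_of_mem_vmrt (hf : ∀ x : 𝔤, (∀ u : V, ⁅x, u⁆ = 0) → x = 0)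
    {t : ℙ ℂ (Tangent b γ)} (ht : t ∈ vmrt b γ v hv.ne_zero) :
    ∃ x : 𝔤, ⁅(gradingElement b γ : 𝔤), x⁆ = x ∧ ⁅x, ⁅x, v⁆⁆ = 0 ∧
      t.submodule = Submodule.span ℂ {(parabolic b γ).mkQ x} := by
  obtain ⟨L, -, hvL, hL, x, hx, rfl, hxL⟩ := ht
  have hZ := lie_projOne hγ x
  have hq := mkQ_projOne hγ x
  have hx1 : projOne b γ x ≠ 0 := fun h => hx (by rw [← hq, h, map_zero])
  have hxv : ⁅projOne b γ x, v⁆ ≠ 0 := fun h => hx1 (eq_zero_of_lie_base_eq_zero hγ hv hZ h)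
  have hmem : ⁅projOne b γ x, v⁆ ∈ L := by
    obtain ⟨c, hc⟩ := (mem_parabolic_iff_lie_base hγ hv).mp (sub_projOne_mem_parabolic hγ x)
    rw [sub_lie, sub_eq_iff_eq_add', ← sub_eq_iff_eq_add] at hc
    rw [← hc]
    exact L.sub_mem hxL (L.smul_mem c hvL)
  refine ⟨projOne b γ x, hZ, lie_lie_base_eq_zero hγ hv hf hZ hxv (hL _ ?_), ?_⟩
  · rw [Projectivization.submodule_mk]
    simpa using hmem
  · rw [Projectivization.submodule_mk, hq]

end HermitianSymmetric

/-! ### Sums of root vectors of strongly orthogonal roots -/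

namespace HermitianSymmetric

open LieAlgebra LieAlgebra.IsKilling LieModule

section Algebra

variable {V : Type*} [AddCommGroup V] [Module ℂ V]

/-- The binomial formula; all terms with a² or higher powers vanish on u. -/
lemma add_pow_succ_apply {a y : Module.End ℂ V} (h : Commute a y) {u : V} (ha : a (a u) = 0)
    (n : ℕ) : ((a + y) ^ (n + 1)) u = (y ^ (n + 1)) u + ((n + 1 : ℕ) : ℂ) • a ((y ^ n) u) := by
  have hy (n : ℕ) (w : V) : a ((y ^ n) w) = (y ^ n) (a w) :=
    congrArg (fun A : Module.End ℂ V => A w) (h.pow_right n).eq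
  induction n with
  | zero => simp [add_comm]
  | succ n ih =>
    rw [pow_succ', Module.End.mul_apply, ih, map_add, LinearMap.add_apply, map_smul,
      LinearMap.add_apply, hy n u, hy n (a u), ha, map_zero, zero_add, ← Module.End.mul_apply y,
      ← pow_succ', ← Module.End.mul_apply y, ← pow_succ', ← hy (n + 1) u]
    push_cast
    module

lemma sum_pow_apply_eq_zero {ι : Type*} [DecidableEq ι] (S : Finset ι) {x : ι → Module.End ℂ V}
    (hx : ∀ i ∈ S, ∀ j ∈ S, Commute (x i) (x j)) {u : V} (hu : ∀ i ∈ S, x i (x i u) = 0) :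
    ((∑ i ∈ S, x i) ^ (S.card + 1)) u = 0 := by
  induction S using Finset.induction_on with
  | empty => simp
  | insert i S hi ih =>
    have h := ih (fun j hj l hl => hx j (Finset.mem_insert_of_mem hj) l (Finset.mem_insert_of_mem hl))
      fun j hj => hu j (Finset.mem_insert_of_mem hj)
    rw [Finset.sum_insert hi, Finset.card_insert_of_notMem hi,
      add_pow_succ_apply (Commute.sum_right _ _ _ fun j hj =>
        hx i (Finset.mem_insert_self _ _) j (Finset.mem_insert_of_mem hj))
        (hu i (Finset.mem_insert_self _ _)), h, pow_succ', Module.End.mul_apply, h]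
    simp

/-- Split off one x i. Applying f i to the two-term expansion kills the power of the remaining sum
and turns the other term into a nonzero multiple of the next lower power, so induction applies. -/
lemma sum_pow_apply_ne_zero {ι : Type*} [DecidableEq ι] (S : Finset ι) {x f : ι → Module.End ℂ V}
    (hx : ∀ i ∈ S, ∀ j ∈ S, Commute (x i) (x j))
    (hf : ∀ i ∈ S, ∀ j ∈ S, i ≠ j → Commute (f i) (x j)) {u : V} (hu0 : u ≠ 0)
    (hu : ∀ i ∈ S, x i (x i u) = 0) (hfu : ∀ i ∈ S, f i u = 0)
    (hfx : ∀ i ∈ S, ∃ c : ℂ, c ≠ 0 ∧ f i (x i u) = c • u) :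
    ((∑ i ∈ S, x i) ^ S.card) u ≠ 0 := by
  induction S using Finset.induction_on with
  | empty => simpa using hu0
  | insert i S hi ih =>
    have hS {j : ι} (hj : j ∈ S) : j ∈ insert i S := Finset.mem_insert_of_mem hj
    have hiS := Finset.mem_insert_self i S
    have h := ih (fun j hj l hl => hx j (hS hj) l (hS hl))
      (fun j hj l hl => hf j (hS hj) l (hS hl)) (fun j hj => hu j (hS hj))
      (fun j hj => hfu j (hS hj)) fun j hj => hfx j (hS hj)
    have hcx : Commute (x i) (∑ j ∈ S, x j) :=
      Commute.sum_right _ _ _ fun j hj => hx i hiS j (hS hj)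
    have hcf : Commute (f i) (∑ j ∈ S, x j) :=
      Commute.sum_right _ _ _ fun j hj => hf i hiS j (hS hj) fun hij => hi (hij ▸ hj)
    rw [Finset.sum_insert hi, Finset.card_insert_of_notMem hi, add_pow_succ_apply hcx (hu i hiS)]
    set y := ∑ j ∈ S, x j
    intro h0
    obtain ⟨c, hc, hc'⟩ := hfx i hiS
    have hfy (n : ℕ) (w : V) : f i ((y ^ n) w) = (y ^ n) (f i w) :=
      congrArg (fun A : Module.End ℂ V => A w) (hcf.pow_right n).eq
    have hxy (n : ℕ) (w : V) : x i ((y ^ n) w) = (y ^ n) (x i w) :=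
      congrArg (fun A : Module.End ℂ V => A w) (hcx.pow_right n).eq
    have h1 := congrArg (f i) h0
    rw [map_add, map_smul, hfy, hfu i hiS, map_zero, zero_add, hxy, hfy, hc', map_smul, map_zero,
      smul_smul] at h1
    refine h ((smul_eq_zero.mp h1).resolve_left (mul_ne_zero ?_ hc))
    exact Nat.cast_ne_zero.mpr (Nat.succ_ne_zero _)

end Algebra

variable {𝔤 : Type*} [LieRing 𝔤] [LieAlgebra ℂ 𝔤] [FiniteDimensional ℂ 𝔤]
  [LieAlgebra.IsKilling ℂ 𝔤] {H : LieSubalgebra ℂ 𝔤} [H.IsCartanSubalgebra]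
  {b : (rootSystem H).Base} {γ : b.support} (hγ : IsCominuscule b γ)

include hγ

/-- Degrees ±2 do not occur: a root β + δ would have degree 2, and a root β - δ would reflect in β
to -β - δ, of degree -2. -/
lemma stronglyOrthogonal_of_pairing_eq_zero {β δ : H.root} (hβ : simpleCoeff b γ β = 1)
    (hδ : simpleCoeff b γ δ = 1) (h : (rootSystem H).pairing δ β = 0) : StronglyOrthogonal β δ := by
  have h2 (k : H.root) : simpleCoeff b γ k ≠ 2 ∧ simpleCoeff b γ k ≠ -2 := by
    rcases hγ k with h | h | h <;> rw [h] <;> norm_num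
  simp only [simpleCoeff_eq_degree] at hβ hδ h2
  refine ⟨?_, ?_, ?_, ?_⟩
  · rintro ⟨k, hk⟩
    refine (h2 k).1 ?_
    rw [hk, map_add, hβ, hδ]
    norm_num
  · intro h0
    have := congrArg (degree b γ) h0
    rw [map_add, hβ, hδ, map_zero] at this
    norm_num at this
  · rintro ⟨k, hk⟩
    refine (h2 ((rootSystem H).reflectionPerm β k)).2 ?_
    have hp : (rootSystem H).pairing k β = 2 := by
      rw [← RootPairing.root_coroot'_eq_pairing, hk, map_sub, RootPairing.root_coroot'_eq_pairing,
        RootPairing.root_coroot'_eq_pairing, h, RootPairing.pairing_same, sub_zero]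
    rw [RootPairing.root_reflectionPerm, RootPairing.reflection_apply_root, hp, hk, map_sub,
      map_sub, map_smul, hβ, hδ]
    norm_num
  · intro h0
    have : β = δ := (rootSystem H).root.injective (sub_eq_zero.mp h0)
    rw [this, RootPairing.pairing_same] at h
    norm_num at h

omit hγ in
lemma StronglyOrthogonal.pairing_eq_zero {β δ : H.root} (h : StronglyOrthogonal β δ) :
    (rootSystem H).pairing β δ = 0 := by
  obtain ⟨h1, h2, h3, h4⟩ := h
  exact (rootSystem H).pairing_eq_zero_of_add_notMem_of_sub_notMem
    (fun h => h4 (by rw [h, sub_self])) (fun h => h2 (by rw [h, neg_add_cancel])) h1 h3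

variable {r : ℕ} {α : Fin r → H.root} (hα : IsMaximalStronglyOrthogonal b γ α)

include hα

lemma IsMaximalStronglyOrthogonal.simpleCoeff_eq_one (i : Fin r) : simpleCoeff b γ (α i) = 1 :=
  (mem_noncompactPos_iff hγ).mp (hα.noncompact i)

lemma IsMaximalStronglyOrthogonal.isCascade : b.IsCascade (degree b γ) γ α where
  grading := hγ
  self := degree_self b γ
  simple := fun _ ha => degree_of_ne b γ ha
  level := fun i => ⟨hα.simpleCoeff_eq_one hγ i, fun j hj =>
    (hα.orthogonal i j fun h => by rw [h] at hj; exact lt_irrefl _ hj).pairing_eq_zero⟩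
  highest := fun i β hβ => hα.highest i β ((mem_noncompactPos_iff hγ).mpr hβ.1) fun j hj =>
    stronglyOrthogonal_of_pairing_eq_zero hγ (hα.simpleCoeff_eq_one hγ j) hβ.1 (hβ.2 j hj)

lemma IsMaximalStronglyOrthogonal.not_level (β : H.root) :
    ¬ (rootSystem H).Level (degree b γ) α r β := by
  intro h
  obtain ⟨i, hi⟩ := hα.maximal β ((mem_noncompactPos_iff hγ).mpr h.1)
  exact hi (stronglyOrthogonal_of_pairing_eq_zero hγ (hα.simpleCoeff_eq_one hγ i) h.1
    (h.2 i i.2))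

omit hγ in
lemma IsMaximalStronglyOrthogonal.lie_eq_zero {i j : Fin r} (hij : i ≠ j) {x y : 𝔤}
    (hx : x ∈ rootSpace H (-(α i).1 : H → ℂ)) (hy : y ∈ rootSpace H (α j).1) : ⁅x, y⁆ = 0 := by
  obtain ⟨-, -, h1, h2⟩ := hα.orthogonal j i hij.symm
  have h := lie_mem_rootSpace_add hx hy
  have e : (-(α i).1 + (α j).1 : H → ℂ) =
      ((rootSystem H).root (α j) - (rootSystem H).root (α i) : Module.Dual ℂ H) := by
    ext z
    simp [sub_eq_neg_add]
  rw [e, rootSpace_eq_bot_of_notMem h2 h1] at h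
  simpa using h

variable {V : Type*} [AddCommGroup V] [Module ℂ V] [LieRingModule 𝔤 V] [LieModule ℂ 𝔤 V]
  [FiniteDimensional ℂ V] {v : V} (hv : IsBaseVector b γ v)

include hv

lemma coroot_lie_base (i : Fin r) : ⁅((rootSystem H).coroot (α i) : 𝔤), v⁆ = -v := by
  have h := (hα.isCascade hγ).apply_coroot_eq_one (l := -baseWeight b γ)
    (by rw [LinearMap.neg_apply, baseWeight_coroot_self, neg_neg])
    (fun a ha => by rw [LinearMap.neg_apply, baseWeight_coroot_of_ne b γ ha, neg_zero]) i
  rw [LinearMap.neg_apply, neg_eq_iff_eq_neg] at h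
  rw [cartan_lie_base hv, h, neg_one_smul]

/-- The coroot has weight -1 on the lowest weight vector v, so the 𝔰𝔩₂-string has two members. -/
lemma lie_lie_base_of_mem_rootSpace {i : Fin r} {x : 𝔤} (hx : x ∈ rootSpace H (α i).1) :
    ⁅x, ⁅x, v⁆⁆ = 0 := by
  by_cases hx0 : x = 0
  · rw [hx0, zero_lie]
  obtain ⟨f, hf, t⟩ := exists_isSl2Triple hx hx0
  exact pow_toEnd_apply_eq_zero_of_isSl2Triple t (u := v) (n := 1)
    (hv.lowest _ (hα.noncompact i).1 f hf) (by rw [coroot_lie_base hγ hα hv]; simp)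

lemma lie_lie_base_of_isSl2Triple {i : Fin r} {e f : 𝔤}
    (hf : f ∈ rootSpace H (-(α i).1 : H → ℂ))
    (t : IsSl2Triple ((rootSystem H).coroot (α i) : 𝔤) e f) : ⁅f, ⁅e, v⁆⁆ = v := by
  rw [leibniz_lie, hv.lowest _ (hα.noncompact i).1 f hf, lie_zero, add_zero, ← lie_skew, t.lie_e_f,
    neg_lie, coroot_lie_base hγ hα hv, neg_neg]

omit hv hα in
lemma commute_toEnd_of_degree_one {x y : 𝔤} (hx : ⁅(gradingElement b γ : 𝔤), x⁆ = x)
    (hy : ⁅(gradingElement b γ : 𝔤), y⁆ = y) : Commute (toEnd ℂ 𝔤 V x) (toEnd ℂ 𝔤 V y) := by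
  refine LinearMap.ext fun u => ?_
  change ⁅x, ⁅y, u⁆⁆ = ⁅y, ⁅x, u⁆⁆
  rw [leibniz_lie, lie_eq_zero_of_degree_one hγ hx hy, zero_lie, zero_add]

omit hv in
lemma IsMaximalStronglyOrthogonal.lie_gradingElement {i : Fin r} {x : 𝔤}
    (hx : x ∈ rootSpace H (α i).1) : ⁅(gradingElement b γ : 𝔤), x⁆ = x := by
  rw [lie_gradingElement_of_mem_rootSpace hx, hα.simpleCoeff_eq_one hγ, one_smul]

lemma sum_pow_base_ne_zero (S : Finset (Fin r)) {e : Fin r → 𝔤}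
    (he : ∀ i, e i ∈ rootSpace H (α i).1) (he0 : ∀ i, e i ≠ 0) :
    (toEnd ℂ 𝔤 V (∑ i ∈ S, e i) ^ S.card) v ≠ 0 := by
  choose f hf t using fun i => exists_isSl2Triple (he i) (he0 i)
  rw [map_sum]
  refine sum_pow_apply_ne_zero S (f := fun i => toEnd ℂ 𝔤 V (f i))
    (fun i _ j _ => commute_toEnd_of_degree_one hγ (hα.lie_gradingElement hγ (he i))
      (hα.lie_gradingElement hγ (he j))) (fun i _ j _ hij => ?_) hv.ne_zero
    (fun i _ => lie_lie_base_of_mem_rootSpace hγ hα hv (he i))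
    (fun i _ => hv.lowest _ (hα.noncompact i).1 _ (hf i))
    (fun i _ => ⟨1, one_ne_zero, by
      rw [one_smul]; exact lie_lie_base_of_isSl2Triple hγ hα hv (hf i) (t i)⟩)
  refine LinearMap.ext fun u => ?_
  change ⁅f i, ⁅e j, u⁆⁆ = ⁅e j, ⁅f i, u⁆⁆
  rw [leibniz_lie, hα.lie_eq_zero hij (hf i) (he j), zero_lie, zero_add]

end HermitianSymmetric

/-! ### The normal form of a vector of degree one under the parabolic subgroup -/

namespace HermitianSymmetric

open LieAlgebra LieAlgebra.IsKilling LieModule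

section SlTwo

variable {𝔤 V : Type*} [LieRing 𝔤] [LieAlgebra ℂ 𝔤] [AddCommGroup V] [Module ℂ V]
  [LieRingModule 𝔤 V] [LieModule ℂ 𝔤 V]

/-- If e f y = 0, then f e^(j+1) y is a strictly negative multiple of e^j y for every j: the
constants start at m and grow by m + 2(j+1). No power of e could then kill y, against nilpotency. -/
lemma lie_lie_ne_zero_of_isSl2Triple {h e f : 𝔤} (t : IsSl2Triple h e f)
    (hn : IsNilpotent (toEnd ℂ 𝔤 V e)) {y : V} (hy0 : y ≠ 0) {m : ℝ} (hm : 0 < m)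
    (hy : ⁅h, y⁆ = (m : ℂ) • y) : ⁅e, ⁅f, y⁆⁆ ≠ 0 := by
  intro h0
  have key (j : ℕ) : (toEnd ℂ 𝔤 V e ^ j) y ≠ 0 ∧
      ⁅h, (toEnd ℂ 𝔤 V e ^ j) y⁆ = ((m + 2 * j : ℝ) : ℂ) • (toEnd ℂ 𝔤 V e ^ j) y ∧
      ∃ c : ℝ, 0 < c ∧ ⁅f, (toEnd ℂ 𝔤 V e ^ (j + 1)) y⁆ = -(c : ℂ) • (toEnd ℂ 𝔤 V e ^ j) y := by
    induction j with
    | zero =>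
      refine ⟨by simpa, by simpa, m, hm, ?_⟩
      have := lie_lie e f y
      rw [t.lie_e_f, hy, h0, zero_sub] at this
      simp [this]
    | succ j ih =>
      obtain ⟨h1, h2, c, hc, h3⟩ := ih
      rw [pow_succ', Module.End.mul_apply, toEnd_apply_apply] at h3 ⊢
      set u := (toEnd ℂ 𝔤 V e ^ j) y with hu
      have h4 : ⁅h, ⁅e, u⁆⁆ = ((m + 2 * (j + 1 : ℕ) : ℝ) : ℂ) • ⁅e, u⁆ := by
        rw [leibniz_lie, t.lie_h_e_smul ℂ, h2, smul_lie, lie_smul]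
        push_cast
        module
      refine ⟨fun h => ?_, h4, c + (m + 2 * (j + 1 : ℕ)), by positivity, ?_⟩
      · rw [h, lie_zero, eq_comm, smul_eq_zero] at h3
        exact h3.elim (by simpa using hc.ne') h1
      · rw [pow_succ', Module.End.mul_apply, toEnd_apply_apply, pow_succ', Module.End.mul_apply,
          toEnd_apply_apply, ← hu]
        have := lie_lie e f ⁅e, u⁆
        rw [t.lie_e_f, h4, h3, lie_smul, eq_sub_iff_add_eq, ← eq_sub_iff_add_eq'] at this
        rw [this]
        push_cast
        module
  obtain ⟨N, hN⟩ := hn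
  exact (key N).1 (by rw [hN, LinearMap.zero_apply])

end SlTwo

variable {𝔤 : Type*} [LieRing 𝔤] [LieAlgebra ℂ 𝔤] [FiniteDimensional ℂ 𝔤]
  [LieAlgebra.IsKilling ℂ 𝔤] {H : LieSubalgebra ℂ 𝔤} [H.IsCartanSubalgebra]

lemma isNilpotent_ad_of_mem_rootSpace {δ : H.root} {e : 𝔤} (he : e ∈ rootSpace H δ.1) :
    IsNilpotent (ad ℂ 𝔤 e) :=
  LieModule.isNilpotent_toEnd_of_mem_rootSpace (M := 𝔤) H (LieSubalgebra.isNonZero_coe_root δ) he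

lemma coe_root_eq_add {β δ ν : H.root}
    (hν : (rootSystem H).root ν = (rootSystem H).root β + (rootSystem H).root δ) :
    (ν.1 : H → ℂ) = β.1 + δ.1 := by
  ext h
  exact LinearMap.congr_fun hν h

/-- If e killed x, then x would be primitive of weight n ≥ 0. A root vector y of the sum root has
weight n + 2 > 0, and f y is a multiple of x, so e f y = 0, which is impossible. -/
lemma lie_ne_zero_of_root_add {μ δ ν : H.root}
    (hν : (rootSystem H).root ν = (rootSystem H).root δ + (rootSystem H).root μ) {e x : 𝔤}
    (he : e ∈ rootSpace H δ.1) (he0 : e ≠ 0) (hx : x ∈ rootSpace H μ.1) (hx0 : x ≠ 0) :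
    ⁅e, x⁆ ≠ 0 := by
  intro h0
  obtain ⟨f, hf, t⟩ := exists_isSl2Triple he he0
  have hprim : t.HasPrimitiveVectorWith x (μ.1 ((rootSystem H).coroot δ)) :=
    ⟨hx0, cartan_lie_of_mem_rootSpace hx _, h0⟩
  obtain ⟨n, hn⟩ := hprim.exists_nat
  obtain ⟨y, hy, hy0⟩ := ν.1.exists_ne_zero
  have hy2 : ⁅((rootSystem H).coroot δ : 𝔤), y⁆ = (((n + 2 : ℕ) : ℝ) : ℂ) • y := by
    rw [cartan_lie_of_mem_rootSpace hy, coe_root_eq_add hν]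
    have : δ.1 ((rootSystem H).coroot δ) = 2 := (rootSystem H).root_coroot_two δ
    rw [Pi.add_apply, hn, this]
    push_cast
    rw [add_comm]
  have h1 : ⁅f, y⁆ ∈ rootSpace H μ.1 := by
    have := lie_mem_rootSpace_add hf hy
    rwa [coe_root_eq_add hν, neg_add_cancel_left] at this
  obtain ⟨c, hc⟩ := exists_eq_smul_of_mem_rootSpace hx hx0 h1
  refine lie_lie_ne_zero_of_isSl2Triple t (isNilpotent_ad_of_mem_rootSpace he) hy0 ?_ hy2 ?_
  · positivity
  · rw [hc, lie_smul, h0, smul_zero]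

/-! #### Sums of root spaces -/

/-- The sum of the root spaces of the roots which satisfy `p`. -/
def rootSum (p : H.root → Prop) : Submodule ℂ 𝔤 :=
  ⨆ β : {β : H.root // p β}, (rootSpace H β.1.1).toSubmodule

lemma mem_rootSum {p : H.root → Prop} {β : H.root} (hβ : p β) {x : 𝔤}
    (hx : x ∈ rootSpace H β.1) : x ∈ rootSum p :=
  Submodule.mem_iSup_of_mem (p := fun β : {β : H.root // p β} => (rootSpace H β.1.1).toSubmodule)
    ⟨β, hβ⟩ hx

lemma rootSum_induction {p : H.root → Prop} {C : 𝔤 → Prop}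
    (mem : ∀ β, p β → ∀ x ∈ rootSpace H β.1, C x) (zero : C 0)
    (add : ∀ x y, C x → C y → C (x + y)) {x : 𝔤} (hx : x ∈ rootSum p) : C x :=
  Submodule.iSup_induction (fun β : {β : H.root // p β} => (rootSpace H β.1.1).toSubmodule)
    (motive := C) hx
    (fun β y hy => mem β.1 β.2 y hy) zero add

lemma cartan_lie_of_mem_rootSum {p : H.root → Prop} {h : H} {c : ℂ} (hp : ∀ β, p β → β.1 h = c)
    {x : 𝔤} (hx : x ∈ rootSum p) : ⁅(h : 𝔤), x⁆ = c • x := by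
  refine rootSum_induction (C := fun x => ⁅(h : 𝔤), x⁆ = c • x) (fun β hβ x hx => ?_) (by simp)
    (fun x y hx hy => ?_) hx
  · rw [cartan_lie_of_mem_rootSpace hx, hp β hβ]
  · rw [lie_add, hx, hy, smul_add]

lemma lie_mem_rootSum {p q : H.root → Prop} {χ : Module.Dual ℂ H}
    (h0 : ∀ β, p β → χ + (rootSystem H).root β ≠ 0)
    (hq : ∀ β, p β → ∀ β', (rootSystem H).root β' = χ + (rootSystem H).root β → q β')
    {z x : 𝔤} (hz : z ∈ rootSpace H (χ : H → ℂ)) (hx : x ∈ rootSum p) : ⁅z, x⁆ ∈ rootSum q := by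
  refine rootSum_induction (C := fun x => ⁅z, x⁆ ∈ rootSum q) (fun β hβ x hx => ?_) (by simp)
    (fun x y hx hy => by rw [lie_add]; exact add_mem hx hy) hx
  have h1 : ⁅z, x⁆ ∈ rootSpace H ((χ + (rootSystem H).root β : Module.Dual ℂ H) : H → ℂ) :=
    lie_mem_rootSpace_add hz hx
  by_cases h : χ + (rootSystem H).root β ∈ Set.range (rootSystem H).root
  · obtain ⟨β', hβ'⟩ := h
    rw [← hβ'] at h1
    exact mem_rootSum (hq β hβ β' hβ') h1
  · rw [rootSpace_eq_bot_of_notMem (h0 β hβ) h, LieSubmodule.mem_bot] at h1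
    rw [h1]
    exact zero_mem _

lemma killingForm_eq_zero_of_mem_rootSum {p : H.root → Prop} {χ : H → ℂ}
    (h : ∀ β, p β → χ + β.1 ≠ 0) {y x : 𝔤} (hy : y ∈ rootSpace H χ) (hx : x ∈ rootSum p) :
    killingForm ℂ 𝔤 y x = 0 :=
  rootSum_induction (C := fun x => killingForm ℂ 𝔤 y x = 0) (fun β hβ _ hx =>
    killingForm_apply_eq_zero_of_mem_rootSpace_of_add_ne_zero ℂ 𝔤 H hy hx (h β hβ)) (by simp)
    (fun x y hx hy => by rw [map_add, hx, hy, add_zero]) hx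

lemma exists_killingForm_ne_zero_of_mem_rootSum {p : H.root → Prop} {x : 𝔤} (hx : x ∈ rootSum p)
    (hx0 : x ≠ 0) : ∃ β, p β ∧ ∃ f ∈ rootSpace H (-β.1 : H → ℂ), killingForm ℂ 𝔤 f x ≠ 0 := by
  by_contra! hcon
  refine hx0 (eq_zero_of_killingForm_eq_zero fun y => ?_)
  induction y using lie_induction (H := H) with
  | cartan h hh =>
    refine killingForm_eq_zero_of_mem_rootSum (χ := (0 : H → ℂ)) (fun β _ => ?_)
      (by rw [rootSpace_zero_eq]; exact hh) hx
    rw [zero_add]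
    exact LieSubalgebra.isNonZero_coe_root β
  | root β y hy =>
    by_cases h : ∃ ν, p ν ∧ (β.1 : H → ℂ) = -ν.1
    · obtain ⟨ν, hν, h⟩ := h
      exact hcon ν hν y (h ▸ hy)
    · exact killingForm_eq_zero_of_mem_rootSum (fun ν hν h' => h ⟨ν, hν,
        eq_neg_of_add_eq_zero_left h'⟩) hy hx
  | add y z hy hz => rw [map_add, LinearMap.add_apply, hy, hz, add_zero]

end HermitianSymmetric

namespace HermitianSymmetric

open LieAlgebra LieAlgebra.IsKilling LieModule

variable {𝔤 : Type*} [LieRing 𝔤] [LieAlgebra ℂ 𝔤] [FiniteDimensional ℂ 𝔤]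
  [LieAlgebra.IsKilling ℂ 𝔤] {H : LieSubalgebra ℂ 𝔤} [H.IsCartanSubalgebra]

lemma exists_coe_eq_neg (β : H.root) : ∃ μ : H.root, (μ.1 : H → ℂ) = -β.1 ∧
    (rootSystem H).root μ = -(rootSystem H).root β := by
  refine ⟨⟨-β.1, ?_⟩, Weight.coe_neg, ?_⟩
  · have := LieSubalgebra.isNonZero_coe_root β
    simpa using this
  · ext h
    simp

/-! ### Moving a nonzero component to a higher root. -/

section Raise

variable {V : Type*} [AddCommGroup V] [Module ℂ V] [LieRingModule 𝔤 V] [LieModule ℂ 𝔤 V]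
  [FiniteDimensional ℂ V]

/-- The β'-component of exp(t e) x is polynomial in t. Its linear coefficient pairs [e, x] with a
vector f' of -β', which by invariance is the pairing of x with a nonzero vector of -β. -/
lemma exists_killingForm_expEnd_ne_zero {β β' δ : H.root}
    (h : (rootSystem H).root β' = (rootSystem H).root β + (rootSystem H).root δ) {e x f : 𝔤}
    (he : e ∈ rootSpace H δ.1) (he0 : e ≠ 0) (hf : f ∈ rootSpace H (-β.1 : H → ℂ))
    (hfx : killingForm ℂ 𝔤 f x ≠ 0) : ∃ (t : ℂ) (f' : 𝔤), f' ∈ rootSpace H (-β'.1 : H → ℂ) ∧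
      killingForm ℂ 𝔤 f' (expEnd (ad ℂ 𝔤 (t • e)) x) ≠ 0 := by
  obtain ⟨μ, hμ, hμ'⟩ := exists_coe_eq_neg β'
  obtain ⟨ν, hν, hν'⟩ := exists_coe_eq_neg β
  obtain ⟨f', hf', hf0⟩ := μ.1.exists_ne_zero
  have hr : (rootSystem H).root ν = (rootSystem H).root δ + (rootSystem H).root μ := by
    rw [hμ', hν', h]; abel
  have hne := lie_ne_zero_of_root_add hr he he0 hf' hf0
  have hmem : ⁅e, f'⁆ ∈ rootSpace H ν.1 := by
    have := lie_mem_rootSpace_add he hf'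
    rwa [← coe_root_eq_add hr] at this
  rw [← hν] at hf
  obtain ⟨c, rfl⟩ := exists_eq_smul_of_mem_rootSpace hmem hne hf
  rw [map_smul, LinearMap.smul_apply, smul_eq_mul, killingForm_lie_left] at hfx
  have hfx' : killingForm ℂ 𝔤 f' ⁅e, x⁆ ≠ 0 := by
    intro h0
    rw [h0] at hfx
    simp at hfx
  by_contra! hcon
  obtain ⟨N, hN⟩ := isNilpotent_ad_of_mem_rootSpace he
  -- The bound N + 2 guarantees that the linear term is present in the sum.
  let q : Polynomial ℂ := ∑ n ∈ Finset.range (N + 2),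
    Polynomial.C ((n.factorial : ℂ)⁻¹ * killingForm ℂ 𝔤 f' ((ad ℂ 𝔤 e ^ n) x)) * Polynomial.X ^ n
  have hpow (t : ℂ) (n : ℕ) : (ad ℂ 𝔤 (t • e) ^ n) x = t ^ n • (ad ℂ 𝔤 e ^ n) x := by
    rw [map_smul, smul_pow, LinearMap.smul_apply]
  have hq : q = 0 := by
    refine Polynomial.funext fun t => ?_
    rw [Polynomial.eval_zero, ← hcon t f' (hμ ▸ hf'),
      expEnd_apply_of_pow_apply_eq_zero (N := N + 2), map_sum, Polynomial.eval_finsetSum]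
    · refine Finset.sum_congr rfl fun n _ => ?_
      rw [map_smul, hpow, map_smul]
      simp only [Polynomial.eval_mul, Polynomial.eval_C, Polynomial.eval_pow, Polynomial.eval_X,
        smul_eq_mul]
      ring
    · rw [hpow, pow_add (ad ℂ 𝔤 e), hN]
      simp
  have h1 := congrArg (fun p => Polynomial.coeff p 1) hq
  simp only [q, Polynomial.finsetSum_coeff, Polynomial.coeff_C_mul, Polynomial.coeff_X_pow,
    Polynomial.coeff_zero] at h1
  rw [Finset.sum_eq_single 1 (fun n _ hn => by simp [hn.symm]) (by simp)] at h1
  simp at h1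
  exact hfx' h1

variable {v : V}

lemma expGroup_mem_parabolicGroup (hv : v ≠ 0) {x : 𝔤} {c : ℂ} (h : ⁅x, v⁆ = c • v) :
    expGroup V x ∈ parabolicGroup 𝔤 (Projectivization.mk ℂ v hv) :=
  (mem_parabolicGroup_iff hv).mpr ⟨Complex.exp c, by
    rw [expGroup_apply, expEnd_apply_of_apply_eq_smul (c := c) h]⟩

end Raise

/-- The elements `x` and `y` are conjugate under an element of the parabolic subgroup which fixes
the first `j` members of the family `e`. -/
def IsParabolicConj {V : Type*} [AddCommGroup V] [Module ℂ V] [LieRingModule 𝔤 V]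
    [LieModule ℂ 𝔤 V] [FiniteDimensional ℂ V] (o : ℙ ℂ V) {r : ℕ} (e : Fin r → 𝔤) (j : ℕ)
    (x y : 𝔤) : Prop :=
  ∃ p ∈ parabolicGroup 𝔤 o, IsAd p x y ∧ ∀ l : Fin r, l.val < j → IsAd p (e l) (e l)

section Conj

variable {V : Type*} [AddCommGroup V] [Module ℂ V] [LieRingModule 𝔤 V]
    [LieModule ℂ 𝔤 V] [FiniteDimensional ℂ V] {o : ℙ ℂ V} {r : ℕ} {e : Fin r → 𝔤} {j : ℕ}

lemma IsParabolicConj.refl (x : 𝔤) : IsParabolicConj o e j x x :=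
  ⟨1, one_mem _, isAd_one x, fun _ _ => isAd_one _⟩

lemma IsParabolicConj.trans {x y z : 𝔤} (h : IsParabolicConj o e j x y)
    (h' : IsParabolicConj o e j y z) : IsParabolicConj o e j x z := by
  obtain ⟨p, hp, hxy, he⟩ := h
  obtain ⟨q, hq, hyz, he'⟩ := h'
  exact ⟨q * p, mul_mem hq hp, hxy.mul hyz, fun l hl => (he l hl).mul (he' l hl)⟩

lemma IsParabolicConj.add_smul {i : Fin r} {x y : 𝔤} (h : IsParabolicConj o e (i.val + 1) x y)
    (c : ℂ) : IsParabolicConj o e i.val (c • e i + x) (c • e i + y) := by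
  obtain ⟨p, hp, hxy, he⟩ := h
  exact ⟨p, hp, ((he i i.val.lt_succ_self).smul c).add hxy,
    fun l hl => he l (hl.trans i.val.lt_succ_self)⟩

lemma isParabolicConj_exp {v : V} (hv : v ≠ 0) {z : 𝔤} {c : ℂ} (hz : ⁅z, v⁆ = c • v)
    (he : ∀ l : Fin r, l.val < j → ⁅z, e l⁆ = 0) (x : 𝔤) :
    IsParabolicConj (Projectivization.mk ℂ v hv) e j x (expEnd (ad ℂ 𝔤 z) x) := by
  refine ⟨expGroup V z, expGroup_mem_parabolicGroup hv hz, isAd_expGroup z x, fun l hl => ?_⟩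
  have := isAd_expGroup (V := V) z (e l)
  rwa [expEnd_apply_of_apply_eq_zero (he l hl)] at this

end Conj

variable {b : (rootSystem H).Base} {γ : b.support}

lemma lie_mem_rootSum_level {r : ℕ} {α : Fin r → H.root} {j : ℕ} {δ : H.root}
    (hδ0 : degree b γ ((rootSystem H).root δ) = 0)
    (hδ : ∀ l : Fin r, l.val < j → (rootSystem H).pairing δ (α l) = 0) {z x : 𝔤}
    (hz : z ∈ rootSpace H δ.1) (hx : x ∈ rootSum ((rootSystem H).Level (degree b γ) α j)) :
    ⁅z, x⁆ ∈ rootSum ((rootSystem H).Level (degree b γ) α j) := by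
  refine lie_mem_rootSum (χ := (rootSystem H).root δ) (fun β hβ h0 => ?_)
    (fun β hβ β' hβ' => ⟨?_, fun l hl => ?_⟩) hz hx
  · have := congrArg (degree b γ) h0
    rw [map_add, hδ0, hβ.1] at this
    simp at this
  · rw [hβ', map_add, hδ0, hβ.1, zero_add]
  · rw [← RootPairing.root_coroot'_eq_pairing, hβ', map_add, RootPairing.root_coroot'_eq_pairing,
      RootPairing.root_coroot'_eq_pairing, hδ l hl, hβ.2 l hl, zero_add]

lemma expEnd_mem_rootSum_level {r : ℕ} {α : Fin r → H.root} {j : ℕ} {δ : H.root}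
    (hδ0 : degree b γ ((rootSystem H).root δ) = 0)
    (hδ : ∀ l : Fin r, l.val < j → (rootSystem H).pairing δ (α l) = 0) {z x : 𝔤}
    (hz : z ∈ rootSpace H δ.1) (hx : x ∈ rootSum ((rootSystem H).Level (degree b γ) α j)) :
    expEnd (ad ℂ 𝔤 z) x ∈ rootSum ((rootSystem H).Level (degree b γ) α j) := by
  obtain ⟨N, hN⟩ := isNilpotent_ad_of_mem_rootSpace hz
  rw [expEnd_apply_of_pow_apply_eq_zero (N := N) (by rw [hN, LinearMap.zero_apply])]
  refine sum_mem fun n hn => Submodule.smul_mem _ _ ?_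
  clear hn
  induction n with
  | zero => simpa
  | succ n ih =>
    rw [pow_succ', Module.End.mul_apply]
    exact lie_mem_rootSum_level hδ0 hδ hz ih

variable (hγ : IsCominuscule b γ) {r : ℕ} {α : Fin r → H.root}
  (hα : IsMaximalStronglyOrthogonal b γ α)
  {V : Type*} [AddCommGroup V] [Module ℂ V] [LieRingModule 𝔤 V] [LieModule ℂ 𝔤 V]
  [FiniteDimensional ℂ V] {v : V} (hv : IsBaseVector b γ v)
  {e : Fin r → 𝔤} (he : ∀ i, e i ∈ rootSpace H (α i).1)

include hγ hα he

/-- Otherwise δ + `α l` is a root of level l pairing to 2 with `α l`, hence equal to `α l`, and δ =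
0. Such conjugations do not disturb the members already split off. -/
lemma lie_eq_zero_of_orthogonal {i : Fin r} {δ : H.root}
    (hδ0 : degree b γ ((rootSystem H).root δ) = 0)
    (hδ : ∀ l : Fin r, l.val < i.val → (rootSystem H).pairing δ (α l) = 0) {z : 𝔤}
    (hz : z ∈ rootSpace H δ.1) {l : Fin r} (hl : l.val < i.val) : ⁅z, e l⁆ = 0 := by
  have h1 : ⁅z, e l⁆ ∈
      rootSpace H (((rootSystem H).root δ + (rootSystem H).root (α l) : Module.Dual ℂ H) : H → ℂ) :=
    lie_mem_rootSpace_add hz (he l)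
  have hl1 : degree b γ ((rootSystem H).root (α l)) = 1 := hα.simpleCoeff_eq_one hγ l
  have hdeg : degree b γ ((rootSystem H).root δ + (rootSystem H).root (α l)) = 1 := by
    rw [map_add, hδ0, hl1, zero_add]
  rw [rootSpace_eq_bot_of_notMem (fun h0 => by rw [h0] at hdeg; simp at hdeg), LieSubmodule.mem_bot]
    at h1
  · exact h1
  rintro ⟨β, hβ⟩
  have hp (m : Fin r) : (rootSystem H).pairing β (α m) =
      (rootSystem H).pairing δ (α m) + (rootSystem H).pairing (α l) (α m) := by
    rw [← RootPairing.root_coroot'_eq_pairing, hβ, map_add, RootPairing.root_coroot'_eq_pairing,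
      RootPairing.root_coroot'_eq_pairing]
  have hc := hα.isCascade hγ
  have hlev : (rootSystem H).Level (degree b γ) α l.val β :=
    ⟨by rw [hβ, hdeg], fun m hm => by
      rw [hp, hδ m (hm.trans hl), (hc.level l).2 m hm, zero_add]⟩
  have h2 : (rootSystem H).pairing β (α l) = 2 := by
    rw [hp, hδ l hl, RootPairing.pairing_same, zero_add]
  have : β = α l := hc.eq_of_two_le_pairingIn hlev (by
    rw [RootPairing.pairing_eq_intCast] at h2
    exact (Int.cast_injective (α := ℂ) (by simpa using h2)).ge)
  rw [this, right_eq_add] at hβ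
  exact (rootSystem H).ne_zero δ hβ

include hv

lemma exists_raise {i : Fin r} {β β' δ : H.root}
    (h : (rootSystem H).root β' = (rootSystem H).root β + (rootSystem H).root δ)
    (hδ0 : degree b γ ((rootSystem H).root δ) = 0)
    (hδ : ∀ l : Fin r, l.val < i.val → (rootSystem H).pairing δ (α l) = 0) {x : 𝔤}
    (hx : x ∈ rootSum ((rootSystem H).Level (degree b γ) α i.val))
    (hβ : ∃ f ∈ rootSpace H (-β.1 : H → ℂ), killingForm ℂ 𝔤 f x ≠ 0) :
    ∃ x', IsParabolicConj (Projectivization.mk ℂ v hv.ne_zero) e i.val x x' ∧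
      x' ∈ rootSum ((rootSystem H).Level (degree b γ) α i.val) ∧
      ∃ f ∈ rootSpace H (-β'.1 : H → ℂ), killingForm ℂ 𝔤 f x' ≠ 0 := by
  obtain ⟨f, hf, hfx⟩ := hβ
  obtain ⟨z, hz, hz0⟩ := δ.1.exists_ne_zero
  obtain ⟨t, f', hf', hne⟩ := exists_killingForm_expEnd_ne_zero h hz hz0 hf hfx
  have hz' : t • z ∈ rootSpace H δ.1 := (rootSpace H δ.1).smul_mem t hz
  refine ⟨_, isParabolicConj_exp hv.ne_zero (c := 0) ?_
    (fun l hl => lie_eq_zero_of_orthogonal hγ hα he hδ0 hδ hz' hl) x,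
    expEnd_mem_rootSum_level hδ0 hδ hz' hx, f', hf', hne⟩
  rw [zero_smul]
  exact lie_base_of_mem_rootSpace hγ hv (β := δ) (by rw [simpleCoeff_eq_degree, hδ0]; simp) hz'

/-- A component orthogonal to the top root is raised by a simple root of degree zero, and one with
positive pairing by the difference to the top root; both raising roots are orthogonal to the earlier
`α l`. -/
lemma exists_raise_top {i : Fin r} {x : 𝔤}
    (hx : x ∈ rootSum ((rootSystem H).Level (degree b γ) α i.val)) (hx0 : x ≠ 0) :
    ∃ x', IsParabolicConj (Projectivization.mk ℂ v hv.ne_zero) e i.val x x' ∧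
      x' ∈ rootSum ((rootSystem H).Level (degree b γ) α i.val) ∧
      ∃ f ∈ rootSpace H (-(α i).1 : H → ℂ), killingForm ℂ 𝔤 f x' ≠ 0 := by
  have hc := hα.isCascade hγ
  obtain ⟨β, hβ, hβx⟩ := exists_killingForm_ne_zero_of_mem_rootSum hx hx0
  clear hx0
  revert x
  refine hc.level_induction i (p := fun β => ∀ {x : 𝔤},
    x ∈ rootSum ((rootSystem H).Level (degree b γ) α i.val) →
    (∃ f ∈ rootSpace H (-β.1 : H → ℂ), killingForm ℂ 𝔤 f x ≠ 0) →
    ∃ x', IsParabolicConj (Projectivization.mk ℂ v hv.ne_zero) e i.val x x' ∧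
      x' ∈ rootSum ((rootSystem H).Level (degree b γ) α i.val) ∧
      ∃ f ∈ rootSpace H (-(α i).1 : H → ℂ), killingForm ℂ 𝔤 f x' ≠ 0) ?_ ?_ hβ
  · intro β hβ hpos x hx hβx
    by_cases hβi : β = α i
    · exact ⟨x, .refl x, hx, hβi ▸ hβx⟩
    · obtain ⟨δ, hδ⟩ := (rootSystem H).root_sub_root_mem_of_pairingIn_pos
        (i := α i) (j := β) (((rootSystem H).zero_lt_pairingIn_iff' ℤ).mp hpos) (Ne.symm hβi)
      refine exists_raise hγ hα hv he (β := β) (δ := δ) (by rw [hδ]; abel) ?_ (fun l hl => ?_) hx hβx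
      · rw [hδ, map_sub, (hc.level i).1, hβ.1, sub_self]
      · rw [← RootPairing.root_coroot'_eq_pairing, hδ, map_sub,
          RootPairing.root_coroot'_eq_pairing, RootPairing.root_coroot'_eq_pairing,
          (hc.level i).2 l hl, hβ.2 l hl, sub_zero]
  · intro β a hβ ha hca hla hneg ih x hx hβx
    obtain ⟨β', hβ'⟩ := (rootSystem H).root_add_root_mem_of_pairingIn_neg hneg (fun h0 => by
      have := congrArg (degree b γ) h0
      rw [map_neg, hca, hβ.1] at this
      simp at this)
    obtain ⟨x', h1, h2, h3⟩ := exists_raise hγ hα hv he hβ' hca hla hx hβx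
    obtain ⟨x'', h4, h5⟩ := (ih β' 1 one_pos (by simpa using hβ')).2 h2 h3
    exact ⟨x'', h1.trans h4, h5⟩

end HermitianSymmetric

/-! ### Splitting off one root vector at a time. -/

namespace HermitianSymmetric

open LieAlgebra LieAlgebra.IsKilling LieModule

variable {𝔤 : Type*} [LieRing 𝔤] [LieAlgebra ℂ 𝔤] [FiniteDimensional ℂ 𝔤]
  [LieAlgebra.IsKilling ℂ 𝔤] {H : LieSubalgebra ℂ 𝔤} [H.IsCartanSubalgebra]
  {b : (rootSystem H).Base} {γ : b.support} {r : ℕ} {α : Fin r → H.root}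

lemma eq_zero_of_mem_rootSum {p : H.root → Prop} (hp : ∀ β, ¬ p β) {x : 𝔤} (hx : x ∈ rootSum p) :
    x = 0 :=
  rootSum_induction (C := fun x => x = 0) (fun β hβ => (hp β hβ).elim) rfl
    (fun x y hx hy => by rw [hx, hy, add_zero]) hx

lemma gradingElement_lie_of_mem_rootSum {p : H.root → Prop} (hp : ∀ β, p β → simpleCoeff b γ β = 1)
    {x : 𝔤} (hx : x ∈ rootSum p) : ⁅(gradingElement b γ : 𝔤), x⁆ = x := by
  simpa using cartan_lie_of_mem_rootSum (h := gradingElement b γ) (c := 1)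
    (fun β hβ => (root_apply_gradingElement b γ β).trans (hp β hβ)) hx

variable (b γ α) in
/-- The roots of a level which are not orthogonal to the top root of the level. -/
def Adjacent (i : Fin r) (β : H.root) : Prop :=
  (rootSystem H).Level (degree b γ) α i.val β ∧ (rootSystem H).pairing β (α i) = 1

lemma Level.succ {i : Fin r} {β : H.root} (h : (rootSystem H).Level (degree b γ) α i.val β)
    (h0 : (rootSystem H).pairing β (α i) = 0) :
    (rootSystem H).Level (degree b γ) α (i.val + 1) β := by
  refine ⟨h.1, fun l hl => ?_⟩
  rcases Nat.lt_succ_iff_lt_or_eq.mp hl with hl | hl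
  · exact h.2 l hl
  · rwa [Fin.ext hl]

variable (hγ : IsCominuscule b γ) (hα : IsMaximalStronglyOrthogonal b γ α)

include hγ hα

lemma exists_add_of_mem_rootSum_level {i : Fin r} {e : 𝔤} (he : e ∈ rootSpace H (α i).1)
    (he0 : e ≠ 0) {x : 𝔤} (hx : x ∈ rootSum ((rootSystem H).Level (degree b γ) α i.val)) :
    ∃ c : ℂ, ∃ x₁ ∈ rootSum (Adjacent b γ α i),
      ∃ x₀ ∈ rootSum ((rootSystem H).Level (degree b γ) α (i.val + 1)), x = c • e + x₁ + x₀ := by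
  refine rootSum_induction (C := fun x => ∃ c : ℂ, ∃ x₁ ∈ rootSum (Adjacent b γ α i),
      ∃ x₀ ∈ rootSum ((rootSystem H).Level (degree b γ) α (i.val + 1)), x = c • e + x₁ + x₀)
    (fun β hβ x hx => ?_) ⟨0, 0, zero_mem _, 0, zero_mem _, by simp⟩ ?_ hx
  · have hc := hα.isCascade hγ
    have h0 := RootPairing.pairingIn_nonneg_of_degree_one hc.grading hβ.1 (hc.level i).1
    have hp := (rootSystem H).pairing_eq_intCast β (α i)
    rcases lt_trichotomy ((rootSystem H).pairingIn ℤ β (α i)) 1 with h | h | h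
    · have h1 : (rootSystem H).pairingIn ℤ β (α i) = 0 := by lia
      rw [h1, Int.cast_zero] at hp
      exact ⟨0, 0, zero_mem _, x, mem_rootSum (Level.succ hβ hp) hx, by simp⟩
    · rw [h, Int.cast_one] at hp
      exact ⟨0, x, mem_rootSum ⟨hβ, hp⟩ hx, 0, zero_mem _, by simp⟩
    · obtain rfl := hc.eq_of_two_le_pairingIn hβ h
      obtain ⟨c, rfl⟩ := exists_eq_smul_of_mem_rootSpace he he0 hx
      exact ⟨c, 0, zero_mem _, 0, zero_mem _, by simp⟩
  · rintro x y ⟨c, x₁, h₁, x₀, h₀, rfl⟩ ⟨d, y₁, h₁', y₀, h₀', rfl⟩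
    exact ⟨c + d, x₁ + y₁, add_mem h₁ h₁', x₀ + y₀, add_mem h₀ h₀', by module⟩

lemma lie_eq_zero_of_mem_rootSum_level {i : Fin r} {f x : 𝔤}
    (hf : f ∈ rootSpace H (-(α i).1 : H → ℂ))
    (hx : x ∈ rootSum ((rootSystem H).Level (degree b γ) α (i.val + 1))) : ⁅f, x⁆ = 0 := by
  have horth {β : H.root} (hβ : (rootSystem H).Level (degree b γ) α (i.val + 1) β) :
      StronglyOrthogonal β (α i) := by
    refine stronglyOrthogonal_of_pairing_eq_zero hγ hβ.1 (hα.simpleCoeff_eq_one hγ i) ?_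
    rw [(rootSystem H).pairing_eq_zero_iff]
    exact hβ.2 i i.val.lt_succ_self
  refine eq_zero_of_mem_rootSum (p := fun _ : H.root => False) (fun _ => id)
    (lie_mem_rootSum (χ := -(rootSystem H).root (α i)) (fun β hβ => ?_) (fun β hβ β' hβ' => ?_)
      (by exact hf) hx)
  · rw [neg_add_eq_sub]
    exact (horth hβ).2.2.2
  · rw [neg_add_eq_sub] at hβ'
    exact (horth hβ).2.2.1 ⟨β', hβ'⟩

omit hγ in
-- The weights are -`α i` + β + δ, of degree one and pairing to -2 + 1 + 1 = 0 with `α i`.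
lemma lie_lie_mem_rootSum_level {i : Fin r} (hi : degree b γ ((rootSystem H).root (α i)) = 1)
    {f x y : 𝔤} (hf : f ∈ rootSpace H (-(α i).1 : H → ℂ)) (hx : x ∈ rootSum (Adjacent b γ α i))
    (hy : y ∈ rootSum (Adjacent b γ α i)) :
    ⁅⁅f, x⁆, y⁆ ∈ rootSum ((rootSystem H).Level (degree b γ) α (i.val + 1)) := by
  refine rootSum_induction (C := fun x => ⁅⁅f, x⁆, y⁆ ∈ rootSum
      ((rootSystem H).Level (degree b γ) α (i.val + 1))) (fun β hβ x hx => ?_) (by simp)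
    (fun x y hx hy => by rw [lie_add, add_lie]; exact add_mem hx hy) hx
  refine lie_mem_rootSum (χ := -(rootSystem H).root (α i) + (rootSystem H).root β)
    (fun δ hδ h0 => ?_) (fun δ hδ δ' hδ' => ?_) (lie_mem_rootSpace_add hf hx) hy
  · have := congrArg (degree b γ) h0
    rw [map_add, map_add, map_neg, hi, hβ.1.1, hδ.1.1] at this
    simp at this
  · have hp (m : Fin r) : (rootSystem H).pairing δ' (α m) =
        -(rootSystem H).pairing (α i) (α m) + (rootSystem H).pairing β (α m) +
          (rootSystem H).pairing δ (α m) := by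
      simp only [← RootPairing.root_coroot'_eq_pairing, hδ', map_add, map_neg]
    refine Level.succ ⟨?_, fun l hl => ?_⟩ ?_
    · rw [hδ', map_add, map_add, map_neg, hi, hβ.1.1, hδ.1.1, neg_add_cancel, zero_add]
    · rw [hp, hβ.1.2 l hl, hδ.1.2 l hl, (hα.orthogonal i l fun h => by
        rw [h] at hl; exact lt_irrefl _ hl).pairing_eq_zero]
      simp
    · rw [hp, hβ.2, hδ.2, RootPairing.pairing_same]
      norm_num

variable {V : Type*} [AddCommGroup V] [Module ℂ V] [LieRingModule 𝔤 V] [LieModule ℂ 𝔤 V]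
  [FiniteDimensional ℂ V] {v : V} (hv : IsBaseVector b γ v)
  {e : Fin r → 𝔤} (he : ∀ i, e i ∈ rootSpace H (α i).1) (he0 : ∀ i, e i ≠ 0)

include he he0 hv

/-- Completing the square: exp(ad y), with y of degree zero, removes the part x₁ adjacent to `α i`
at the cost of a quadratic correction in the next level. The coefficient c is nonzero because root
vectors of -`α i` see only the multiple of e i. -/
lemma exists_clear {i : Fin r} {x : 𝔤}
    (hx : x ∈ rootSum ((rootSystem H).Level (degree b γ) α i.val))
    (hfx : ∃ f ∈ rootSpace H (-(α i).1 : H → ℂ), killingForm ℂ 𝔤 f x ≠ 0) :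
    ∃ c : ℂ, c ≠ 0 ∧ ∃ x' ∈ rootSum ((rootSystem H).Level (degree b γ) α (i.val + 1)),
      IsParabolicConj (Projectivization.mk ℂ v hv.ne_zero) e i.val x (c • e i + x') := by
  obtain ⟨c, x₁, h₁, x₀, h₀, rfl⟩ := exists_add_of_mem_rootSum_level hγ hα (he i) (he0 i) hx
  have hi : degree b γ ((rootSystem H).root (α i)) = 1 := hα.simpleCoeff_eq_one hγ i
  have hc : c ≠ 0 := by
    rintro rfl
    obtain ⟨f, hf, hne⟩ := hfx
    rw [zero_smul, zero_add, map_add, killingForm_eq_zero_of_mem_rootSum (fun β hβ h0 => ?_) hf h₁,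
      killingForm_eq_zero_of_mem_rootSum (fun β hβ h0 => ?_) hf h₀, add_zero] at hne
    · exact hne rfl
    · obtain rfl : β = α i := by
        refine (rootSystem H).root.injective (LinearMap.ext fun h => ?_)
        have := congrFun h0 h
        exact (neg_add_eq_zero.mp this).symm
      have := hβ.2 i i.val.lt_succ_self
      rw [RootPairing.pairing_same] at this
      norm_num at this
    · obtain rfl : β = α i := by
        refine (rootSystem H).root.injective (LinearMap.ext fun h => ?_)
        have := congrFun h0 h
        exact (neg_add_eq_zero.mp this).symm
      have := hβ.2
      rw [RootPairing.pairing_same] at this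
      norm_num at this
  obtain ⟨f, hf, t⟩ := exists_isSl2Triple (he i) (he0 i)
  have hZ₁ : ⁅(gradingElement b γ : 𝔤), x₁⁆ = x₁ :=
    gradingElement_lie_of_mem_rootSum (fun β hβ => hβ.1.1) h₁
  have hZe (l : Fin r) := hα.lie_gradingElement hγ (he l)
  have hxe (l : Fin r) : ⁅x₁, e l⁆ = 0 := lie_eq_zero_of_degree_one hγ hZ₁ (hZe l)
  have hZ₀ {y : 𝔤} (hy : y ∈ rootSum ((rootSystem H).Level (degree b γ) α (i.val + 1))) :
      ⁅x₁, y⁆ = 0 :=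
    lie_eq_zero_of_degree_one hγ hZ₁ (gradingElement_lie_of_mem_rootSum (fun β hβ => hβ.1) hy)
  have hh : ⁅((rootSystem H).coroot (α i) : 𝔤), x₁⁆ = x₁ := by
    simpa using cartan_lie_of_mem_rootSum (c := 1) (fun β hβ => hβ.2) h₁
  -- Chosen so that [y, c e i] = -x₁, as the coroot of `α i` fixes x₁.
  set y : 𝔤 := c⁻¹ • ⁅f, x₁⁆ with hy
  have hye : ⁅y, c • e i⁆ = -x₁ := by
    rw [hy, smul_lie, lie_smul, smul_smul, inv_mul_cancel₀ hc, one_smul, lie_lie, hxe, lie_zero,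
      ← lie_skew f, t.lie_e_f, lie_neg, ← lie_skew x₁, hh]
    simp
  have hyl {l : Fin r} (hl : l.val < i.val) : ⁅y, e l⁆ = 0 := by
    rw [hy, smul_lie, lie_lie, hxe, lie_zero, hα.lie_eq_zero (i := i) (j := l) (fun h => by
      rw [h] at hl; exact lt_irrefl _ hl) hf (he l), lie_zero, sub_zero, smul_zero]
  have hy₀ {z : 𝔤} (hz : z ∈ rootSum ((rootSystem H).Level (degree b γ) α (i.val + 1))) :
      ⁅y, z⁆ = 0 := by
    rw [hy, smul_lie, lie_lie, hZ₀ hz, lie_eq_zero_of_mem_rootSum_level hγ hα hf hz, lie_zero,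
      lie_zero, sub_zero, smul_zero]
  have hy₁ : ⁅y, x₁⁆ ∈ rootSum ((rootSystem H).Level (degree b γ) α (i.val + 1)) := by
    rw [hy, smul_lie]
    exact Submodule.smul_mem _ _ (lie_lie_mem_rootSum_level hα hi hf h₁ h₁)
  obtain ⟨d, hd⟩ : ∃ d : ℂ, ⁅y, v⁆ = d • v := by
    rw [← mem_parabolic_iff_lie_base hγ hv, mem_parabolic_iff hγ]
    refine projOne_of_lie_eq_zero ?_
    have hZf : ⁅(gradingElement b γ : 𝔤), f⁆ = -f := by
      rw [cartan_lie_of_mem_rootSpace hf, Pi.neg_apply, root_apply_gradingElement,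
        hα.simpleCoeff_eq_one hγ, neg_one_smul]
    rw [hy, lie_smul, leibniz_lie, hZf, hZ₁, neg_lie, neg_add_cancel, smul_zero]
  refine ⟨c, hc, x₀ + (2⁻¹ : ℂ) • ⁅y, x₁⁆, add_mem h₀ (Submodule.smul_mem _ _ hy₁), ?_⟩
  convert isParabolicConj_exp hv.ne_zero hd (fun l hl => hyl hl) (c • e i + x₁ + x₀) using 1
  have hp1 : ad ℂ 𝔤 y (c • e i + x₁ + x₀) = -x₁ + ⁅y, x₁⁆ := by
    rw [ad_apply, lie_add, lie_add, hye, hy₀ h₀, add_zero]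
  have hp2 : ad ℂ 𝔤 y (-x₁ + ⁅y, x₁⁆) = -⁅y, x₁⁆ := by
    rw [ad_apply, lie_add, hy₀ hy₁, lie_neg, add_zero]
  -- The series stops after the quadratic term because ad y kills the next level; the corrections
  -- [y, x₁] and -[y, x₁]/2 leave one half.
  rw [expEnd_apply_of_pow_apply_eq_zero (N := 3)]
  · simp only [Finset.sum_range_succ, Finset.sum_range_zero, pow_succ', pow_zero,
      Module.End.mul_apply, Module.End.one_apply, hp1, hp2]
    simp only [Nat.factorial_zero, Nat.factorial_one, Nat.factorial_two, Nat.cast_one,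
      Nat.cast_ofNat, inv_one]
    module
  · simp only [pow_succ', pow_zero, Module.End.mul_apply, Module.End.one_apply, hp1, hp2]
    rw [ad_apply, lie_neg, hy₀ hy₁, neg_zero]

lemma exists_isParabolicConj_sum_smul {n j : ℕ} (hj : j + n = r) {x : 𝔤}
    (hx : x ∈ rootSum ((rootSystem H).Level (degree b γ) α j)) :
    ∃ s, j ≤ s ∧ s ≤ r ∧ ∃ c : Fin r → ℂ, (∀ i, c i ≠ 0) ∧
      IsParabolicConj (Projectivization.mk ℂ v hv.ne_zero) e j x
        (∑ i : Fin r with j ≤ i.val ∧ i.val < s, c i • e i) := by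
  induction n generalizing j x with
  | zero =>
    obtain rfl := hj
    refine ⟨j, le_rfl, le_rfl, fun _ => 1, fun _ => one_ne_zero, ?_⟩
    rw [eq_zero_of_mem_rootSum (hα.not_level hγ) hx, Finset.sum_eq_zero]
    · exact .refl 0
    · intro i hi
      simp at hi
      lia
  | succ n ih =>
    by_cases hx0 : x = 0
    · refine ⟨j, le_rfl, by lia, fun _ => 1, fun _ => one_ne_zero, ?_⟩
      rw [hx0, Finset.sum_eq_zero]
      · exact .refl 0
      · intro i hi
        simp at hi
        lia
    · obtain ⟨i, rfl⟩ : ∃ i : Fin r, i.val = j := ⟨⟨j, by lia⟩, rfl⟩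
      obtain ⟨x', hx', h1, h2⟩ := exists_raise_top hγ hα hv he hx hx0
      obtain ⟨c, hc, x'', hx'', h3⟩ := exists_clear hγ hα hv he he0 h1 h2
      obtain ⟨s, hs, hsr, d, hd, h4⟩ := ih (j := i.val + 1) (by lia) hx''
      refine ⟨s, by lia, hsr, Function.update d i c, fun l => ?_, ?_⟩
      · by_cases hl : l = i
        · rw [hl, Function.update_self]; exact hc
        · rw [Function.update_of_ne hl]; exact hd l
      · convert (hx'.trans h3).trans (h4.add_smul c) using 1
        have hset : (Finset.univ.filter fun l : Fin r => i.val ≤ l.val ∧ l.val < s) =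
            insert i (Finset.univ.filter fun l : Fin r => i.val + 1 ≤ l.val ∧ l.val < s) := by
          ext l
          simp only [Finset.mem_filter, Finset.mem_univ, true_and, Finset.mem_insert, Fin.ext_iff]
          lia
        rw [hset, Finset.sum_insert (by simp), Function.update_self]
        congr 1
        refine Finset.sum_congr rfl fun l hl => ?_
        rw [Function.update_of_ne]
        rintro rfl
        simp at hl

omit he0 hγ in
lemma exists_scale {c : Fin r → ℂ} (hc : ∀ i, c i ≠ 0) : ∃ p ∈ parabolicGroup 𝔤
    (Projectivization.mk ℂ v hv.ne_zero), ∀ i, IsAd p (c i • e i) (e i) := by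
  -- By orthogonality `α i` takes the value -log (c i) on h, so exp(h) rescales each e i separately.
  set h : H := ∑ i, (-(Complex.log (c i)) / 2) • (rootSystem H).coroot (α i) with hh
  refine ⟨expGroup V (h : 𝔤), expGroup_mem_parabolicGroup hv.ne_zero (cartan_lie_base hv h),
    fun i => ?_⟩
  convert isAd_expGroup (h : 𝔤) (c i • e i)
  have hi : (α i).1 h = -Complex.log (c i) := by
    change (rootSystem H).root (α i) h = _
    rw [hh, map_sum, Finset.sum_eq_single i]
    · rw [map_smul]
      have : (rootSystem H).root (α i) ((rootSystem H).coroot (α i)) = 2 :=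
        (rootSystem H).root_coroot_two _
      rw [this, smul_eq_mul, div_mul_cancel₀ _ two_ne_zero]
    · intro j _ hji
      have : (rootSystem H).root (α i) ((rootSystem H).coroot (α j)) = 0 :=
        (hα.orthogonal i j hji.symm).pairing_eq_zero
      rw [map_smul, this, smul_zero]
    · simp
  rw [expEnd_apply_of_apply_eq_smul (c := -Complex.log (c i)), Complex.exp_neg,
    Complex.exp_log (hc i), inv_smul_smul₀ (hc i)]
  rw [map_smul, ad_apply, cartan_lie_of_mem_rootSpace (he i), hi, smul_comm]

/-- The normal form of a vector of degree one under the parabolic subgroup. -/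
lemma exists_isAd_sum {x : 𝔤} (hx : ⁅(gradingElement b γ : 𝔤), x⁆ = x) :
    ∃ s ≤ r, ∃ p ∈ parabolicGroup 𝔤 (Projectivization.mk ℂ v hv.ne_zero),
      IsAd p x (∑ i : Fin r with i.val < s, e i) := by
  have hx' : x ∈ rootSum ((rootSystem H).Level (degree b γ) α 0) := by
    rw [← projOne_of_lie_eq_self hx]
    clear hx
    induction x using lie_induction (H := H) with
    | cartan h hh =>
      rw [projOne_of_lie_eq_zero (cartan_lie_cartan _ ⟨h, hh⟩)]
      exact zero_mem _
    | root β x hx =>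
      have h := lie_gradingElement_of_mem_rootSpace (b := b) (γ := γ) hx
      rw [projOne_of_lie_eq_smul h]
      by_cases h1 : simpleCoeff b γ β = 1
      · exact Submodule.smul_mem _ _ (mem_rootSum ⟨h1, fun i hi => by lia⟩ hx)
      · convert zero_mem (rootSum ((rootSystem H).Level (degree b γ) α 0))
        rcases hγ β with h | h | h
        · rw [h]; norm_num
        · rw [h]; norm_num
        · exact (h1 h).elim
    | add x y hx hy => rw [map_add]; exact add_mem hx hy
  obtain ⟨s, -, hs, c, hc, p, hp, hpx, -⟩ :=
    exists_isParabolicConj_sum_smul hγ hα hv he he0 (zero_add r) hx'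
  obtain ⟨q, hq, hqe⟩ := exists_scale hα hv he hc
  refine ⟨s, hs, q * p, mul_mem hq hp, hpx.mul ?_⟩
  simp only [zero_le, true_and]
  exact IsAd.sum _ fun i _ => hqe i

end HermitianSymmetric

/-! ### Tangent directions of lines, and equations of the rank varieties -/

namespace Projectivization

variable {T : Type*} [AddCommGroup T] [Module ℂ T]

lemma subset_zariskiClosure (S : Set (ℙ ℂ T)) : S ⊆ zariskiClosure S :=
  fun t ht _ _ _ h => h t ht

/-- The vectors killed by the power of a linear family of endomorphisms are Zariski closed. -/
lemma exists_isHomogeneous_polyEval_eq [FiniteDimensional ℂ T] {V : Type*} [AddCommGroup V]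
    [Module ℂ V] (σ : T →ₗ[ℂ] Module.End ℂ V) (u : V) (n : ℕ) (φ : V →ₗ[ℂ] ℂ) :
    ∃ f : MvPolynomial (Module.Dual ℂ T) ℂ, f.IsHomogeneous n ∧
      ∀ w, polyEval f w = φ ((σ w ^ n) u) := by
  induction n generalizing φ with
  | zero =>
    exact ⟨MvPolynomial.C (φ u), MvPolynomial.isHomogeneous_C _ _, fun w => by simp [polyEval]⟩
  | succ n ih =>
    let B := Module.finBasis ℂ T
    choose f hf hfw using fun j => ih (φ ∘ₗ σ (B j))
    refine ⟨∑ j, MvPolynomial.X (B.coord j) * f j, ?_, fun w => ?_⟩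
    · refine MvPolynomial.IsHomogeneous.sum _ _ _ fun j _ => ?_
      rw [add_comm n]
      exact (MvPolynomial.isHomogeneous_X _ _).mul (hf j)
    · have hw : σ w = ∑ j, B.coord j w • σ (B j) := by
        conv_lhs => rw [← B.sum_repr w, map_sum]
        simp
      rw [pow_succ', Module.End.mul_apply]
      conv_rhs => rw [show σ w ((σ w ^ n) u) = (∑ j, B.coord j w • σ (B j)) ((σ w ^ n) u) from
        congrArg (fun A : Module.End ℂ V => A ((σ w ^ n) u)) hw]
      rw [LinearMap.sum_apply, map_sum, polyEval, map_sum]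
      refine Finset.sum_congr rfl fun j _ => ?_
      rw [map_mul, MvPolynomial.eval_X, LinearMap.smul_apply, map_smul, smul_eq_mul]
      congr 1
      exact hfw j w

end Projectivization

namespace HermitianSymmetric

open LieAlgebra LieAlgebra.IsKilling LieModule

variable {𝔤 : Type*} [LieRing 𝔤] [LieAlgebra ℂ 𝔤] [FiniteDimensional ℂ 𝔤]
  [LieAlgebra.IsKilling ℂ 𝔤] {H : LieSubalgebra ℂ 𝔤} [H.IsCartanSubalgebra]
  {b : (rootSystem H).Base} {γ : b.support} (hγ : IsCominuscule b γ)
  {V : Type*} [AddCommGroup V] [Module ℂ V] [LieRingModule 𝔤 V] [LieModule ℂ 𝔤 V]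
  [FiniteDimensional ℂ V] {v : V} (hv : IsBaseVector b γ v)

lemma IsAd.pow_apply {g : group 𝔤 V} {x y : 𝔤} (h : IsAd g x y) (n : ℕ) (u : V) :
    (toEnd ℂ 𝔤 V y ^ n) ((g : V ≃ₗ[ℂ] V) u) = (g : V ≃ₗ[ℂ] V) ((toEnd ℂ 𝔤 V x ^ n) u) := by
  induction n with
  | zero => rfl
  | succ n ih =>
    rw [pow_succ', pow_succ', Module.End.mul_apply, Module.End.mul_apply, ih]
    exact h _

include hγ hv

/-- The line is the p-translate of the span of v and e v: its points are exp(s e) v, together with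
the point at infinity e v. -/
lemma mem_vmrt_of_isAd {r : ℕ} {α : Fin r → H.root} (hα : IsMaximalStronglyOrthogonal b γ α)
    {i : Fin r} {e y : 𝔤} (he : e ∈ rootSpace H (α i).1) {p : group 𝔤 V}
    (hp : p ∈ parabolicGroup 𝔤 (Projectivization.mk ℂ v hv.ne_zero)) (hy : IsAd p e y)
    (hy0 : (parabolic b γ).mkQ y ≠ 0) :
    Projectivization.mk ℂ ((parabolic b γ).mkQ y) hy0 ∈ vmrt b γ v hv.ne_zero := by
  have he0 : e ≠ 0 := by
    rintro rfl
    refine hy0 ((Submodule.Quotient.mk_eq_zero _).mpr ?_)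
    exact IsAd.mem_parabolic hγ hv hp hy (zero_mem _)
  obtain ⟨f, hf, t⟩ := exists_isSl2Triple he he0
  have hev := lie_lie_base_of_mem_rootSpace hγ hα hv he
  have hfev := lie_lie_base_of_isSl2Triple hγ hα hv hf t
  have hfv := hv.lowest _ (hα.noncompact i).1 f hf
  obtain ⟨c, hc⟩ := (mem_parabolicGroup_iff hv.ne_zero).mp hp
  have hc0 := ne_zero_of_smul_eq hv.ne_zero hc
  have hexp (s : ℂ) : (expGroup V (s • e) : V ≃ₗ[ℂ] V) v = v + s • ⁅e, v⁆ := by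
    rw [expGroup_apply, expEnd_apply_of_pow_apply_eq_zero (N := 2)]
    · simp [Finset.sum_range_succ]
    · simp [pow_two, hev]
  -- The point at infinity also lies in the orbit: exp(-f) exp(e) v = e v, since f e v = v.
  have hexp' : (expGroup V (-f) : V ≃ₗ[ℂ] V) (v + ⁅e, v⁆) = ⁅e, v⁆ := by
    rw [expGroup_apply, expEnd_apply_of_pow_apply_eq_zero (N := 2)]
    · simp [Finset.sum_range_succ, hfv, hfev]
    · simp [pow_two, hfv, hfev]
  set F : V ≃ₗ[ℂ] V := (p : V ≃ₗ[ℂ] V)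
  refine ⟨(Submodule.span ℂ {v, ⁅e, v⁆}).map (F : V →ₗ[ℂ] V), ?_, ?_, fun q hq => ?_, y, hy0, rfl, ?_⟩
  · have hli : LinearIndependent ℂ ![v, ⁅e, v⁆] := by
      refine LinearIndependent.pair_iff.mpr fun s s' h => ?_
      have h1 := congrArg (fun u => ⁅f, u⁆) h
      simp only [lie_add, lie_smul, hfv, hfev, smul_zero, zero_add, lie_zero] at h1
      have h2 := (smul_eq_zero.mp h1).resolve_right hv.ne_zero
      rw [h2, zero_smul, add_zero] at h
      exact ⟨(smul_eq_zero.mp h).resolve_right hv.ne_zero, h2⟩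
    have h := finrank_span_eq_card hli
    rw [LinearEquiv.finrank_map_eq]
    rwa [Matrix.range_cons_cons_empty, Fintype.card_fin] at h
  · refine ⟨c⁻¹ • v, Submodule.smul_mem _ _ (Submodule.subset_span (by simp)), ?_⟩
    rw [LinearEquiv.coe_coe, map_smul, ← hc, inv_smul_smul₀ hc0]
  · induction q using Projectivization.ind with
    | h u hu =>
      rw [Projectivization.submodule_mk, Submodule.span_singleton_le_iff_mem] at hq
      obtain ⟨u, hu', rfl⟩ := hq
      obtain ⟨s, s', rfl⟩ := Submodule.mem_span_pair.mp hu'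
      rw [mem_variety_iff hv.ne_zero hu]
      by_cases hs : s = 0
      · have hs' : s' ≠ 0 := by
          rintro rfl
          simp [hs] at hu
        refine ⟨p * (expGroup V (-f) * expGroup V ((1 : ℂ) • e)), s'⁻¹, ?_⟩
        change _ = F ((expGroup V (-f) : V ≃ₗ[ℂ] V) ((expGroup V ((1 : ℂ) • e) : V ≃ₗ[ℂ] V) v))
        rw [hexp, one_smul, hexp', hs, zero_smul, zero_add, LinearEquiv.coe_coe, map_smul,
          inv_smul_smul₀ hs']
      · refine ⟨p * expGroup V ((s⁻¹ * s') • e), s⁻¹, ?_⟩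
        change _ = F ((expGroup V ((s⁻¹ * s') • e) : V ≃ₗ[ℂ] V) v)
        rw [hexp, LinearEquiv.coe_coe, ← map_smul, smul_add, inv_smul_smul₀ hs, smul_smul]
  · refine ⟨c⁻¹ • ⁅e, v⁆, Submodule.smul_mem _ _ (Submodule.subset_span (by simp)), ?_⟩
    rw [LinearEquiv.coe_coe, map_smul, ← hy v, ← hc, lie_smul, inv_smul_smul₀ hc0]

lemma mem_secantVariety_of_hasTangentRank {r : ℕ} {α : Fin r → H.root}
    (hα : IsMaximalStronglyOrthogonal b γ α) {e : Fin r → 𝔤}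
    (he : ∀ i, e i ∈ rootSpace H (α i).1) (he0 : ∀ i, e i ≠ 0) {k s : ℕ} (hsk : s ≤ k)
    {w : Tangent b γ} (hw : w ≠ 0) (h : HasTangentRank b γ v hv.ne_zero e w s) :
    Projectivization.mk ℂ w hw ∈ Projectivization.secantVariety (vmrt b γ v hv.ne_zero) k := by
  obtain ⟨hs1, hsr, p, hp, x, y, rfl, hxy, hy⟩ := h
  choose z hz using fun i => exists_isAd p⁻¹ (e i)
  have hp' := inv_mem hp
  have hz0 (i : Fin r) : (parabolic b γ).mkQ (z i) ≠ 0 := by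
    intro h0
    have h1 : e i ∈ parabolic b γ := by
      refine IsAd.mem_parabolic hγ hv hp (x := z i) ?_ ((Submodule.Quotient.mk_eq_zero _).mp h0)
      simpa using (hz i).inv
    have h2 := (mem_parabolic_iff hγ).mp h1
    rw [projOne_of_lie_eq_self (hα.lie_gradingElement hγ (he i))] at h2
    exact he0 i h2
  have hsum : (parabolic b γ).mkQ x = ∑ i : Fin r with i.val < s, (parabolic b γ).mkQ (z i) := by
    rw [← map_sum, ← sub_eq_zero, ← map_sub]
    refine (Submodule.Quotient.mk_eq_zero _).mpr (IsAd.mem_parabolic hγ hv hp'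
      (hxy.inv.sub (IsAd.sum _ fun i _ => hz i)) ((Submodule.Quotient.mk_eq_zero _).mp ?_))
    rw [← map_sum, ← sub_eq_zero, ← map_sub] at hy
    exact hy
  -- Exactly k points are required; when s < k, the one of index s - 1 is repeated.
  refine Projectivization.subset_zariskiClosure _ ⟨fun l => Projectivization.mk ℂ _
    (hz0 ⟨min l.val (s - 1), by lia⟩), fun l => mem_vmrt_of_isAd hγ hv hα (he _) hp' (hz _) _, ?_⟩
  rw [Projectivization.submodule_mk, Submodule.span_singleton_le_iff_mem, hsum]
  refine sum_mem fun i hi => ?_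
  have his : i.val < s := by simpa using hi
  refine Submodule.mem_iSup_of_mem ⟨i.val, by lia⟩ ?_
  rw [Projectivization.submodule_mk]
  have hi' : (⟨min i.val (s - 1), by lia⟩ : Fin r) = i := Fin.ext (by dsimp only; lia)
  simp only [hi']
  exact Submodule.mem_span_singleton_self _

/-! ### Power equations and the bound on the rank. -/

omit hv in
/-- The representative of degree one of a tangent vector. -/
def tangentLift : Tangent b γ →ₗ[ℂ] 𝔤 :=
  (parabolic b γ).liftQ (projOne b γ) fun _ hx => (mem_parabolic_iff hγ).mp hx

omit hv in
lemma tangentLift_mkQ (x : 𝔤) : tangentLift hγ ((parabolic b γ).mkQ x) = projOne b γ x :=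
  Submodule.liftQ_apply _ _ _

omit hv in
lemma mkQ_tangentLift (w : Tangent b γ) : (parabolic b γ).mkQ (tangentLift hγ w) = w := by
  obtain ⟨x, rfl⟩ := (parabolic b γ).mkQ_surjective w
  rw [tangentLift_mkQ, mkQ_projOne hγ]

omit hv in
lemma lie_tangentLift (w : Tangent b γ) :
    ⁅(gradingElement b γ : 𝔤), tangentLift hγ w⁆ = tangentLift hγ w := by
  obtain ⟨x, rfl⟩ := (parabolic b γ).mkQ_surjective w
  rw [tangentLift_mkQ, lie_projOne hγ]

/-- Each coordinate of x^(k+1) v is a homogeneous polynomial of degree k + 1 in the tangent vector.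
It vanishes on spans of k line directions, whose lifts commute and have square zero on v, hence on
the closure. -/
lemma pow_tangentLift_apply_eq_zero (hf : ∀ x : 𝔤, (∀ u : V, ⁅x, u⁆ = 0) → x = 0) {k : ℕ}
    {w : Tangent b γ} (hw : w ≠ 0) (h : Projectivization.mk ℂ w hw ∈
      Projectivization.secantVariety (vmrt b γ v hv.ne_zero) k) :
    (toEnd ℂ 𝔤 V (tangentLift hγ w) ^ (k + 1)) v = 0 := by
  refine eq_of_forall_linearMap_eq fun φ => ?_
  obtain ⟨f, hfh, hfw⟩ := Projectivization.exists_isHomogeneous_polyEval_eq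
    ((toEnd ℂ 𝔤 V : 𝔤 →ₗ[ℂ] Module.End ℂ V) ∘ₗ tangentLift hγ) v (k + 1) φ
  rw [map_zero]
  refine (hfw w).symm.trans (h (k + 1) f hfh ?_ w
    (by rw [Projectivization.submodule_mk]; exact Submodule.mem_span_singleton_self w) hw)
  rintro s ⟨a, ha, has⟩ w' hw' -
  rw [hfw w']
  choose x hZ hx hxa using fun i => exists_of_mem_vmrt hγ hv hf (ha i)
  have hmem := has hw'
  simp only [hxa] at hmem
  rw [Submodule.iSup_span, Set.iUnion_singleton_eq_range, Submodule.mem_span_range_iff_exists_fun]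
    at hmem
  obtain ⟨c, rfl⟩ := hmem
  have hsum : ((toEnd ℂ 𝔤 V : 𝔤 →ₗ[ℂ] Module.End ℂ V) ∘ₗ tangentLift hγ)
      (∑ i, c i • (parabolic b γ).mkQ (x i)) = ∑ i, toEnd ℂ 𝔤 V (c i • x i) := by
    rw [map_sum]
    refine Finset.sum_congr rfl fun i _ => ?_
    rw [← map_smul, LinearMap.comp_apply, tangentLift_mkQ, map_smul, projOne_of_lie_eq_self (hZ i)]
    rfl
  have hZc (i : Fin k) : ⁅(gradingElement b γ : 𝔤), c i • x i⁆ = c i • x i := by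
    rw [lie_smul, hZ]
  have := sum_pow_apply_eq_zero Finset.univ (x := fun i => toEnd ℂ 𝔤 V (c i • x i)) (u := v)
    (fun i _ j _ => commute_toEnd_of_degree_one hγ (hZc i) (hZc j)) (fun i _ => by simp [hx])
  rw [Finset.card_univ, Fintype.card_fin] at this
  rw [hsum, this, map_zero]

lemma exists_hasTangentRank_of_mem_secantVariety
    (hf : ∀ x : 𝔤, (∀ u : V, ⁅x, u⁆ = 0) → x = 0) {r : ℕ} {α : Fin r → H.root}
    (hα : IsMaximalStronglyOrthogonal b γ α) {e : Fin r → 𝔤}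
    (he : ∀ i, e i ∈ rootSpace H (α i).1) (he0 : ∀ i, e i ≠ 0) {k : ℕ}
    {w : Tangent b γ} (hw : w ≠ 0) (h : Projectivization.mk ℂ w hw ∈
      Projectivization.secantVariety (vmrt b γ v hv.ne_zero) k) :
    ∃ s ≤ k, HasTangentRank b γ v hv.ne_zero e w s := by
  have hpow := pow_tangentLift_apply_eq_zero hγ hv hf hw h
  obtain ⟨s, hsr, p, hp, hpx⟩ := exists_isAd_sum hγ hα hv he he0 (lie_tangentLift hγ w)
  refine ⟨s, ?_, ?_, hsr, p, hp, _, _, mkQ_tangentLift hγ w, hpx, map_sum _ _ _⟩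
  -- If s > k, conjugating the vanishing power to the normal form makes the s-th power of the sum of
  -- s root vectors kill v.
  · by_contra! hks
    obtain ⟨c, hc⟩ := (mem_parabolicGroup_iff hv.ne_zero).mp hp
    have h1 := hpx.pow_apply (k + 1) v
    rw [hpow, map_zero, ← hc, map_smul] at h1
    have h2 := (smul_eq_zero.mp h1).resolve_left (ne_zero_of_smul_eq hv.ne_zero hc)
    have h3 := sum_pow_base_ne_zero hγ hα hv (Finset.univ.filter fun i : Fin r => i.val < s) he he0
    have hcard : (Finset.univ.filter fun i : Fin r => i.val < s).card = s := by
      rw [Fin.card_filter_val_lt, min_eq_right hsr]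
    obtain ⟨n, hn⟩ := Nat.exists_eq_add_of_le' (Nat.succ_le_of_lt hks)
    refine h3 ?_
    have hn' (A : Module.End ℂ V) : A ^ s = A ^ n * A ^ (k + 1) := by rw [hn, pow_add]
    rw [hcard, hn', Module.End.mul_apply, h2, map_zero]
  · by_contra! hs
    obtain rfl : s = 0 := by lia
    refine hw ?_
    rw [← mkQ_tangentLift hγ w, hf (tangentLift hγ w) fun u => ?_, map_zero]
    have := hpx u
    simp only [Nat.not_lt_zero, Finset.filter_false, Finset.sum_empty, zero_lie] at this
    exact (p : V ≃ₗ[ℂ] V).map_eq_zero_iff.mp this.symm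

omit hγ in
-- The kernel of the representation is an ideal, and it is proper because the coroot of γ acts on v
-- by -1.
lemma eq_zero_of_forall_lie_eq_zero [LieAlgebra.IsSimple ℂ 𝔤] {x : 𝔤}
    (hx : ∀ u : V, ⁅x, u⁆ = 0) : x = 0 := by
  rcases LieAlgebra.IsSimple.eq_bot_or_eq_top (R := ℂ) (LieModule.ker ℂ 𝔤 V) with h | h
  · rwa [← LieSubmodule.mem_bot (R := ℂ) (L := 𝔤), ← h, LieModule.mem_ker]
  · have h1 : ((rootSystem H).coroot γ : 𝔤) ∈ LieModule.ker ℂ 𝔤 V := by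
      rw [h]
      exact LieSubmodule.mem_top _
    rw [LieModule.mem_ker] at h1
    have h2 := hv.weight_self
    rw [h1, zero_eq_neg] at h2
    exact (hv.ne_zero h2).elim

end HermitianSymmetric

theorem mainTheorem10
    {𝔤 : Type*} [LieRing 𝔤] [LieAlgebra ℂ 𝔤] [FiniteDimensional ℂ 𝔤] [LieAlgebra.IsSimple ℂ 𝔤]
    (H : LieSubalgebra ℂ 𝔤) [H.IsCartanSubalgebra]
    (b : (LieAlgebra.IsKilling.rootSystem H).Base)
    (γ : b.support) (hγ : HermitianSymmetric.IsCominuscule b γ)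
    {V : Type*} [AddCommGroup V] [Module ℂ V] [FiniteDimensional ℂ V]
    [LieRingModule 𝔤 V] [LieModule ℂ 𝔤 V] [LieModule.IsIrreducible ℂ 𝔤 V]
    (v : V) (hv : HermitianSymmetric.IsBaseVector b γ v)
    {r : ℕ} (α : Fin r → H.root)
    (hα : HermitianSymmetric.IsMaximalStronglyOrthogonal b γ α)
    (e : Fin r → 𝔤) (he : ∀ i, e i ∈ LieAlgebra.rootSpace H (α i).1) (he0 : ∀ i, e i ≠ 0)
    (k : ℕ) (hk : 1 ≤ k) :
    Projectivization.secantVariety (HermitianSymmetric.vmrt b γ v hv.ne_zero) k =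
      {t | ∃ (w : HermitianSymmetric.Tangent b γ) (hw : w ≠ 0),
        t = Projectivization.mk ℂ w hw ∧
        ∃ r₀ ≤ k, HermitianSymmetric.HasTangentRank b γ v hv.ne_zero e w r₀} := by
  ext t
  constructor
  · intro ht
    induction t using Projectivization.ind with
    | h w hw =>
      exact ⟨w, hw, rfl, HermitianSymmetric.exists_hasTangentRank_of_mem_secantVariety hγ hv
        (fun _ => HermitianSymmetric.eq_zero_of_forall_lie_eq_zero hv) hα he he0 hw ht⟩
  · rintro ⟨w, hw, rfl, s, hs, h⟩
    exact HermitianSymmetric.mem_secantVariety_of_hasTangentRank hγ hv hα he he0 hs hw h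

end
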